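/- Let $T$ be a set of base types. Simple types over $T$ are generated by $\tau ::= \theta \mid 1 \mid \tau_1 * \tau_2 \mid \tau_1 \Rightarrow \tau_2$ ($\theta\in T$). Let $\mathbb{C}$ be the category of typing contexts $\Gamma$ (finite lists of types) and type-preserving renamings of variables. For a type $\tau$ let $\mathcal{L}_\tau,\mathcal{M}_\tau,\mathcal{N}_\tau:\mathbb{C}\to\mathbf{Set}$ be the presheaves of simply typed $\lambda$-terms (with unit, pairs and functions, up to renaming of bound variables), neutral terms and normal terms of type $\tau$, with action by renaming; here neutral terms $M$ and normal terms (long $\beta\eta$-normal forms) $N$ are given by mutual induction: variables are neutral; $\pi_i(M)$ and $M(N)$ are neutral; $\langle\rangle$, $\langle N_1,N_2\rangle$ and $\lambda x.N$ are normal; and a neutral term of base type is normal. Let $s:T\to\mathcal{S}$ be an interpretation of base types in a cartesian closed category, with its induced interpretation $s[\![-]\!]$ of types, contexts and terms. Let $\mathcal{G}_s$ be the cartesian closed glueing category of triples $(P,\;p:P\to\mathcal{S}(s[\![-]\!],A),\;A)$ with $P:\mathbb{C}\to\mathbf{Set}$ and $A\in\mathcal{S}$; write $\bar y(\Gamma)=(\mathbb{C}(\Gamma,-),\,s[\![-]\!],\,s[\![\Gamma]\!])$,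 and let $V_\tau$, $\mu_\tau$, $\nu_\tau$ be the glued objects over $s[\![\tau]\!]$ of variables, neutral terms and normal terms of type $\tau$ with their semantics. Let $\bar s:T\to\mathcal{G}_s$, $\theta\mapsto\mu_\theta$, and let $\mu_\tau\xrightarrow{u_\tau}\bar s[\![\tau]\!]\xrightarrow{q_\tau}\nu_\tau$ be the unquote and quote maps, defined by induction on $\tau$: - $u_\theta=\mathrm{id}$ and $q_\theta$ is the identification of neutral and normal terms of base type; - $u_1$ is the unique map and $q_1=(\mathsf{unit},\mathrm{id})$; - $u_{\tau*\tau'}=\langle u_\tau\circ(\mathsf{fst},\pi_1),\,u_{\tau'}\circ(\mathsf{snd},\pi_2)\rangle$ and $q_{\tau*\tau'}=(\mathsf{pair},\mathrm{id})\circ(q_\tau\times q_{\tau'})$; - $u_{\tau\Rightarrow\tau'}$ is the exponential transpose of $u_{\tau'}\circ(\mathsf{app},\varepsilon)\circ(\mathrm{id}\times q_\tau)$, and $q_{\tau\Rightarrow\tau'}=(\mathsf{abs},\mathrm{id})\circ q_{\tau'}^{\,u_\tau v_\tau}$, where $v_\tau=(\mathsf{var},\mathrm{id}):V_\tau\to\mu_\tau$.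 The normalisation function induced by $s$ is the natural transformation $\mathrm{nf}^s_\tau:\mathcal{L}_\tau\to\mathcal{N}_\tau$ sending $t\in\mathcal{L}_\tau(\Gamma)$ to the value at $\mathrm{id}_\Gamma$ of the presheaf component of $$\bar y(\Gamma)\to\prod_{(x:\sigma)\in\Gamma}\mu_\sigma\xrightarrow{\prod u_\sigma}\bar s[\![\Gamma]\!]\xrightarrow{\bar s[\![t]\!]}\bar s[\![\tau]\!]\xrightarrow{q_\tau}\nu_\tau ,$$ where the first map tuples the variables of $\Gamma$. Let $f:T\to\mathcal{F}_{\mathrm{ccc}}[T]$ be the universal interpretation in the free cartesian closed category on $T$. Corollary. For every interpretation $s:T\to\mathcal{S}$ of base types in a cartesian closed category and every type $\tau$, $$\mathrm{nf}^s_\tau=\mathrm{nf}^f_\tau:\mathcal{L}_\tau\to\mathcal{N}_\tau\quad\text{in }\mathbf{Set}^{\mathbb{C}}.$$ Consequently all interpretations induce one and the same normalisation function, and for every term $t\in\mathcal{L}_\tau(\Gamma)$ its value $\mathrm{nf}^f_\tau(t)$ is the unique normal term in $\mathcal{N}_\tau(\Gamma)$ that is $\beta\eta$-equal to $t$. -/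

import Mathlib

open CategoryTheory MonoidalCategory CartesianMonoidalCategory Opposite

universe u v w

namespace NbE

/-! ### Syntax of the simply typed lambda calculus -/

/-- Simple types over a set `T` of base types. -/
inductive Ty (T : Type u) : Type u
  | base : T → Ty T
  | unit : Ty T
  | prod : Ty T → Ty T → Ty T
  | arr : Ty T → Ty T → Ty T

/-- Typing contexts, generated from the empty context by context extension. -/
inductive Ctx (T : Type u) : Type u
  | nil : Ctx T
  | ext : Ctx T → Ty T → Ctx T

/-- `Var Γ τ` is the set of variables (de Bruijn indices) declared with type `τ` in `Γ`. -/
inductive Var {T : Type u} : Ctx T → Ty T → Type u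
  | zero {Γ : Ctx T} {τ : Ty T} : Var (Γ.ext τ) τ
  | succ {Γ : Ctx T} {τ σ : Ty T} : Var Γ τ → Var (Γ.ext σ) τ

/-- Type-preserving context renamings. -/
@[ext]
structure Ren {T : Type u} (Γ Δ : Ctx T) : Type u where
  app : ∀ {τ : Ty T}, Var Γ τ → Var Δ τ

/-- The category of contexts and type-preserving renamings. -/
instance Ctx.category (T : Type u) : SmallCategory (Ctx T) where
  Hom := Ren
  id _ := ⟨fun x => x⟩
  comp ρ ρ' := ⟨fun x => ρ'.app (ρ.app x)⟩

section Terms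

variable {T : Type u}

/-- The renaming `Γ → Γ, x : σ`. -/
def Ren.wk (Γ : Ctx T) (σ : Ty T) : Γ ⟶ Γ.ext σ := ⟨Var.succ⟩

/-- A function on the variables of `Γ` extended to the variables of `Γ, x : σ`. -/
def liftVar {Γ Δ : Ctx T} (σ : Ty T) (ρ : Γ ⟶ Δ) :
    ∀ {τ : Ty T}, Var (Γ.ext σ) τ → Var (Δ.ext σ) τ
  | _, .zero => .zero
  | _, .succ x => .succ (ρ.app x)

/-- The renaming `Γ, x : σ → Δ, x : σ` induced by a renaming `Γ → Δ`. -/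
def Ren.lift {Γ Δ : Ctx T} (σ : Ty T) (ρ : Γ ⟶ Δ) : Γ.ext σ ⟶ Δ.ext σ := ⟨liftVar σ ρ⟩

/-- `Tm Γ τ` is the set of terms of type `τ` in context `Γ` (up to renaming of bound variables). -/
inductive Tm : Ctx T → Ty T → Type u
  | var {Γ : Ctx T} {τ : Ty T} : Var Γ τ → Tm Γ τ
  | unit {Γ : Ctx T} : Tm Γ .unit
  | fst {Γ : Ctx T} {σ τ : Ty T} : Tm Γ (.prod σ τ) → Tm Γ σ
  | snd {Γ : Ctx T} {σ τ : Ty T} : Tm Γ (.prod σ τ) → Tm Γ τ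
  | pair {Γ : Ctx T} {σ τ : Ty T} : Tm Γ σ → Tm Γ τ → Tm Γ (.prod σ τ)
  | app {Γ : Ctx T} {σ τ : Ty T} : Tm Γ (.arr σ τ) → Tm Γ σ → Tm Γ τ
  | lam {Γ : Ctx T} {σ τ : Ty T} : Tm (Γ.ext σ) τ → Tm Γ (.arr σ τ)

namespace Tm

/-- The action of a renaming on terms. -/
def rename {Γ Δ : Ctx T} {τ : Ty T} (ρ : Γ ⟶ Δ) : Tm Γ τ → Tm Δ τ
  | var x => var (ρ.app x)
  | unit => unit
  | fst t => fst (rename ρ t)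
  | snd t => snd (rename ρ t)
  | pair t t' => pair (rename ρ t) (rename ρ t')
  | app t t' => app (rename ρ t) (rename ρ t')
  | lam t => lam (rename (Ren.lift _ ρ) t)

/-- A simultaneous substitution extended under a binder. -/
def liftSub {Γ Δ : Ctx T} (σ : Ty T) (θ : ∀ τ : Ty T, Var Γ τ → Tm Δ τ) :
    ∀ τ : Ty T, Var (Γ.ext σ) τ → Tm (Δ.ext σ) τ
  | _, .zero => var .zero
  | _, .succ x => rename (Ren.wk Δ σ) (θ _ x)

/-- Simultaneous (capture-avoiding) substitution. -/
def subst {Γ Δ : Ctx T} {τ : Ty T} (θ : ∀ τ : Ty T, Var Γ τ → Tm Δ τ) : Tm Γ τ → Tm Δ τ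
  | var x => θ _ x
  | unit => unit
  | fst t => fst (subst θ t)
  | snd t => snd (subst θ t)
  | pair t t' => pair (subst θ t) (subst θ t')
  | app t t' => app (subst θ t) (subst θ t')
  | lam t => lam (subst (liftSub _ θ) t)

/-- The substitution sending the last variable to `a` and fixing the others. -/
def single {Γ : Ctx T} {σ : Ty T} (a : Tm Γ σ) : ∀ τ : Ty T, Var (Γ.ext σ) τ → Tm Γ τ
  | _, .zero => a
  | _, .succ x => var x

end Tm

/-- `βη`-equality of terms. -/
inductive BetaEta : ∀ {Γ : Ctx T} {τ : Ty T}, Tm Γ τ → Tm Γ τ → Prop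
  | refl {Γ : Ctx T} {τ : Ty T} (t : Tm Γ τ) : BetaEta t t
  | symm {Γ : Ctx T} {τ : Ty T} {t t' : Tm Γ τ} : BetaEta t t' → BetaEta t' t
  | trans {Γ : Ctx T} {τ : Ty T} {t t' t'' : Tm Γ τ} :
      BetaEta t t' → BetaEta t' t'' → BetaEta t t''
  | fst_congr {Γ : Ctx T} {σ τ : Ty T} {t t' : Tm Γ (.prod σ τ)} :
      BetaEta t t' → BetaEta t.fst t'.fst
  | snd_congr {Γ : Ctx T} {σ τ : Ty T} {t t' : Tm Γ (.prod σ τ)} :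
      BetaEta t t' → BetaEta t.snd t'.snd
  | pair_congr {Γ : Ctx T} {σ τ : Ty T} {a a' : Tm Γ σ} {b b' : Tm Γ τ} :
      BetaEta a a' → BetaEta b b' → BetaEta (a.pair b) (a'.pair b')
  | app_congr {Γ : Ctx T} {σ τ : Ty T} {t t' : Tm Γ (.arr σ τ)} {a a' : Tm Γ σ} :
      BetaEta t t' → BetaEta a a' → BetaEta (t.app a) (t'.app a')
  | lam_congr {Γ : Ctx T} {σ τ : Ty T} {t t' : Tm (Γ.ext σ) τ} :
      BetaEta t t' → BetaEta t.lam t'.lam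
  | beta_fst {Γ : Ctx T} {σ τ : Ty T} (a : Tm Γ σ) (b : Tm Γ τ) : BetaEta (a.pair b).fst a
  | beta_snd {Γ : Ctx T} {σ τ : Ty T} (a : Tm Γ σ) (b : Tm Γ τ) : BetaEta (a.pair b).snd b
  | beta_app {Γ : Ctx T} {σ τ : Ty T} (t : Tm (Γ.ext σ) τ) (a : Tm Γ σ) :
      BetaEta (t.lam.app a) (t.subst (Tm.single a))
  | eta_unit {Γ : Ctx T} (t : Tm Γ .unit) : BetaEta t .unit
  | eta_pair {Γ : Ctx T} {σ τ : Ty T} (t : Tm Γ (.prod σ τ)) : BetaEta t (t.fst.pair t.snd)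
  | eta_lam {Γ : Ctx T} {σ τ : Ty T} (t : Tm Γ (.arr σ τ)) :
      BetaEta t ((t.rename (Ren.wk Γ σ)).app (.var .zero)).lam

mutual

/-- Neutral terms. -/
inductive IsNeutral : ∀ {Γ : Ctx T} {τ : Ty T}, Tm Γ τ → Prop
  | var {Γ : Ctx T} {τ : Ty T} (x : Var Γ τ) : IsNeutral (.var x)
  | fst {Γ : Ctx T} {σ τ : Ty T} {M : Tm Γ (.prod σ τ)} : IsNeutral M → IsNeutral M.fst
  | snd {Γ : Ctx T} {σ τ : Ty T} {M : Tm Γ (.prod σ τ)} : IsNeutral M → IsNeutral M.snd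
  | app {Γ : Ctx T} {σ τ : Ty T} {M : Tm Γ (.arr σ τ)} {N : Tm Γ σ} :
      IsNeutral M → IsNormal N → IsNeutral (M.app N)

/-- Normal terms, i.e. long `βη`-normal forms. -/
inductive IsNormal : ∀ {Γ : Ctx T} {τ : Ty T}, Tm Γ τ → Prop
  | unit {Γ : Ctx T} : IsNormal (.unit (Γ := Γ))
  | pair {Γ : Ctx T} {σ τ : Ty T} {N : Tm Γ σ} {N' : Tm Γ τ} :
      IsNormal N → IsNormal N' → IsNormal (N.pair N')
  | lam {Γ : Ctx T} {σ τ : Ty T} {N : Tm (Γ.ext σ) τ} : IsNormal N → IsNormal N.lam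
  | base {Γ : Ctx T} {b : T} {M : Tm Γ (.base b)} : IsNeutral M → IsNormal M

end

theorem Ren.lift_id {Γ : Ctx T} (σ : Ty T) : Ren.lift σ (𝟙 Γ) = 𝟙 (Γ.ext σ) := by
  apply Ren.ext
  funext τ x
  cases x <;> rfl

theorem Ren.lift_comp {Γ Δ Θ : Ctx T} (σ : Ty T) (ρ : Γ ⟶ Δ) (ρ' : Δ ⟶ Θ) :
    Ren.lift σ (ρ ≫ ρ') = Ren.lift σ ρ ≫ Ren.lift σ ρ' := by
  apply Ren.ext
  funext τ x
  cases x <;> rfl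

theorem Ren.wk_lift {Γ Δ : Ctx T} (σ : Ty T) (ρ : Γ ⟶ Δ) :
    Ren.wk Γ σ ≫ Ren.lift σ ρ = ρ ≫ Ren.wk Δ σ := rfl

theorem Tm.rename_id {Γ : Ctx T} {τ : Ty T} (t : Tm Γ τ) : t.rename (𝟙 Γ) = t := by
  induction t with
  | var x => rfl
  | unit => rfl
  | fst t ih => simp only [rename, ih]
  | snd t ih => simp only [rename, ih]
  | pair t t' ih ih' => simp only [rename, ih, ih']
  | app t t' ih ih' => simp only [rename, ih, ih']
  | lam t ih => simp only [rename, Ren.lift_id, ih]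

theorem Tm.rename_comp {Γ Δ Θ : Ctx T} {τ : Ty T} (t : Tm Γ τ) (ρ : Γ ⟶ Δ) (ρ' : Δ ⟶ Θ) :
    t.rename (ρ ≫ ρ') = (t.rename ρ).rename ρ' := by
  induction t generalizing Δ Θ with
  | var x => rfl
  | unit => rfl
  | fst t ih => simp only [rename, ih]
  | snd t ih => simp only [rename, ih]
  | pair t t' ih ih' => simp only [rename, ih, ih']
  | app t t' ih ih' => simp only [rename, ih, ih']
  | lam t ih => simp only [rename, Ren.lift_comp, ih]

mutual

theorem IsNeutral.rename {Γ Δ : Ctx T} {τ : Ty T} {t : Tm Γ τ} (ρ : Γ ⟶ Δ) :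
    IsNeutral t → IsNeutral (t.rename ρ)
  | .var x => .var _
  | .fst h => .fst (h.rename ρ)
  | .snd h => .snd (h.rename ρ)
  | .app h h' => .app (h.rename ρ) (h'.rename ρ)

theorem IsNormal.rename {Γ Δ : Ctx T} {τ : Ty T} {t : Tm Γ τ} (ρ : Γ ⟶ Δ) :
    IsNormal t → IsNormal (t.rename ρ)
  | .unit => .unit
  | .pair h h' => .pair (h.rename ρ) (h'.rename ρ)
  | .lam h => .lam (h.rename (Ren.lift _ ρ))
  | .base h => .base (h.rename ρ)

end

/-- Neutral terms of type `τ` in context `Γ`. -/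
def Ne (Γ : Ctx T) (τ : Ty T) : Type u := {t : Tm Γ τ // IsNeutral t}

/-- Normal terms of type `τ` in context `Γ`. -/
def Nf (Γ : Ctx T) (τ : Ty T) : Type u := {t : Tm Γ τ // IsNormal t}

/-- The presheaf of variables of type `τ`. -/
def varPsh (τ : Ty T) : Ctx T ⥤ Type u where
  obj Γ := Var Γ τ
  map ρ := ↾fun x => ρ.app x

/-- The presheaf of terms of type `τ`, with action given by variable renaming. -/
def tmPsh (τ : Ty T) : Ctx T ⥤ Type u where
  obj Γ := Tm Γ τ
  map ρ := ↾fun t => t.rename ρ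
  map_id Γ := by ext t; exact t.rename_id
  map_comp ρ ρ' := by ext t; exact t.rename_comp ρ ρ'

/-- The presheaf of neutral terms of type `τ`. -/
def nePsh (τ : Ty T) : Ctx T ⥤ Type u where
  obj Γ := Ne Γ τ
  map ρ := ↾fun M => ⟨M.1.rename ρ, M.2.rename ρ⟩
  map_id Γ := by ext M; exact Subtype.ext M.1.rename_id
  map_comp ρ ρ' := by ext M; exact Subtype.ext (M.1.rename_comp ρ ρ')

/-- The presheaf of normal terms of type `τ`. -/
def nfPsh (τ : Ty T) : Ctx T ⥤ Type u where
  obj Γ := Nf Γ τ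
  map ρ := ↾fun N => ⟨N.1.rename ρ, N.2.rename ρ⟩
  map_id Γ := by ext N; exact Subtype.ext N.1.rename_id
  map_comp ρ ρ' := by ext N; exact Subtype.ext (N.1.rename_comp ρ ρ')

end Terms

/-! ### Semantics in cartesian closed categories -/

section Semantics

variable {T : Type u} {C : Type w} [Category.{v} C] [CartesianMonoidalCategory C]

/-- The product `∏_{(x : τ) ∈ Γ} D τ` of a type-indexed family of objects over a context. -/
@[reducible]
def ctxProd (D : Ty T → C) : Ctx T → C
  | .nil => 𝟙_ C
  | .ext Γ τ => D τ ⊗ ctxProd D Γ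

/-- The projection of `∏_{(x : τ) ∈ Γ} D τ` at a variable. -/
def ctxProj (D : Ty T → C) : ∀ {Γ : Ctx T} {τ : Ty T}, Var Γ τ → (ctxProd D Γ ⟶ D τ)
  | _, _, .zero => fst _ _
  | _, _, .succ x => snd _ _ ≫ ctxProj D x

/-- The tupling of a family of morphisms indexed by the variables of a context. -/
def ctxLift (D : Ty T → C) {X : C} :
    ∀ {Γ : Ctx T}, (∀ τ : Ty T, Var Γ τ → (X ⟶ D τ)) → (X ⟶ ctxProd D Γ)
  | .nil, _ => toUnit X
  | .ext _ _, g => lift (g _ .zero) (ctxLift D fun τ x => g τ (.succ x))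

/-- The product over a context of a type-indexed family of morphisms. -/
def ctxMap {D E : Ty T → C} (g : ∀ τ : Ty T, D τ ⟶ E τ) (Γ : Ctx T) :
    ctxProd D Γ ⟶ ctxProd E Γ :=
  ctxLift E fun τ x => ctxProj D x ≫ g τ

/-- The contravariant action of renamings on products over contexts. -/
def ctxRen (D : Ty T → C) {Γ Δ : Ctx T} (ρ : Γ ⟶ Δ) : ctxProd D Δ ⟶ ctxProd D Γ :=
  ctxLift D fun _ x => ctxProj D (ρ.app x)

theorem ctxLift_proj (D : Ty T → C) {X : C} {Γ : Ctx T}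
    (g : ∀ τ : Ty T, Var Γ τ → (X ⟶ D τ)) {τ : Ty T} (x : Var Γ τ) :
    ctxLift D g ≫ ctxProj D x = g τ x := by
  induction x with
  | zero => simp [ctxLift, ctxProj]
  | succ x ih => simp [ctxLift, ctxProj, ih]

theorem ctxRen_proj (D : Ty T → C) {Γ Δ : Ctx T} (ρ : Γ ⟶ Δ) {τ : Ty T} (x : Var Γ τ) :
    ctxRen D ρ ≫ ctxProj D x = ctxProj D (ρ.app x) :=
  ctxLift_proj D _ x

theorem ctxProd_hom_ext (D : Ty T → C) {X : C} {Γ : Ctx T} {f g : X ⟶ ctxProd D Γ}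
    (h : ∀ (τ : Ty T) (x : Var Γ τ), f ≫ ctxProj D x = g ≫ ctxProj D x) : f = g := by
  induction Γ with
  | nil => exact toUnit_unique _ _
  | ext Γ σ ih =>
    apply CartesianMonoidalCategory.hom_ext
    · exact h σ .zero
    · apply ih
      intro τ x
      simpa [ctxProj] using h τ (.succ x)

/-- Products over contexts and the action of renamings on them, as a functor. -/
def ctxFunctor (D : Ty T → C) : (Ctx T)ᵒᵖ ⥤ C where
  obj Γ := ctxProd D Γ.unop
  map ρ := ctxRen D ρ.unop
  map_id Γ := by
    apply ctxProd_hom_ext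
    intro τ x
    rw [ctxRen_proj, Category.id_comp]
    rfl
  map_comp ρ ρ' := by
    apply ctxProd_hom_ext
    intro τ x
    rw [Category.assoc, ctxRen_proj, ctxRen_proj, ctxRen_proj]
    rfl

theorem ctxRen_wk (D : Ty T → C) (Γ : Ctx T) (σ : Ty T) :
    ctxRen D (Ren.wk Γ σ) = snd (D σ) (ctxProd D Γ) := by
  apply ctxProd_hom_ext
  intro τ x
  rw [ctxRen_proj]
  rfl

theorem ctxRen_lift (D : Ty T → C) {Γ Δ : Ctx T} (σ : Ty T) (ρ : Γ ⟶ Δ) :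
    ctxRen D (Ren.lift σ ρ) = D σ ◁ ctxRen D ρ := by
  apply ctxProd_hom_ext
  intro τ x
  rw [ctxRen_proj]
  cases x with
  | zero => simp [Ren.lift, liftVar, ctxProj]
  | succ x => simp [Ren.lift, liftVar, ctxProj, ctxRen_proj]

variable [MonoidalClosed C]

/-- The extension of an interpretation `s` of base types to simple types. -/
@[reducible]
def tySem (s : T → C) : Ty T → C
  | .base b => s b
  | .unit => 𝟙_ C
  | .prod σ τ => tySem s σ ⊗ tySem s τ
  | .arr σ τ => (ihom (tySem s σ)).obj (tySem s τ)

/-- The functor interpreting contexts and their renamings. -/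
abbrev ctxSem (s : T → C) : (Ctx T)ᵒᵖ ⥤ C := ctxFunctor (tySem s)

/-- The interpretation of a term `Γ ⊢ t : τ` as a morphism from `Γ` to `τ`. -/
def tmSem (s : T → C) : ∀ {Γ : Ctx T} {τ : Ty T}, Tm Γ τ → (ctxProd (tySem s) Γ ⟶ tySem s τ)
  | _, _, .var x => ctxProj (tySem s) x
  | _, _, .unit => toUnit _
  | _, _, .fst t => tmSem s t ≫ fst _ _
  | _, _, .snd t => tmSem s t ≫ snd _ _
  | _, _, .pair t t' => lift (tmSem s t) (tmSem s t')
  | _, _, .app t t' => lift (tmSem s t') (tmSem s t) ≫ (ihom.ev _).app _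
  | _, _, .lam t => MonoidalClosed.curry (tmSem s t)

theorem tmSem_rename (s : T → C) {Γ Δ : Ctx T} {τ : Ty T} (t : Tm Γ τ) (ρ : Γ ⟶ Δ) :
    tmSem s (t.rename ρ) = ctxRen (tySem s) ρ ≫ tmSem s t := by
  induction t generalizing Δ with
  | var x => exact (ctxRen_proj _ ρ x).symm
  | unit => exact toUnit_unique _ _
  | fst t ih => simp only [Tm.rename, tmSem, ih, Category.assoc]
  | snd t ih => simp only [Tm.rename, tmSem, ih, Category.assoc]
  | pair t t' ih ih' => simp only [Tm.rename, tmSem, ih, ih', comp_lift]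
  | app t t' ih ih' => simp only [Tm.rename, tmSem, ih, ih', comp_lift_assoc]
  | lam t ih =>
    simp only [Tm.rename, tmSem, ih, ctxRen_lift]
    exact MonoidalClosed.curry_natural_left _ _

end Semantics

/-! ### The free cartesian closed category on a set -/

section Free

/-- Formal arrows between simple types, generated by the operations of a cartesian closed
category. -/
inductive Arr {T : Type u} : Ty T → Ty T → Type u
  | id (A : Ty T) : Arr A A
  | comp {A B C : Ty T} : Arr A B → Arr B C → Arr A C
  | toUnit (A : Ty T) : Arr A .unit
  | fst (A B : Ty T) : Arr (.prod A B) A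
  | snd (A B : Ty T) : Arr (.prod A B) B
  | lift {X A B : Ty T} : Arr X A → Arr X B → Arr X (.prod A B)
  | curry {X A B : Ty T} : Arr (.prod A X) B → Arr X (.arr A B)
  | ev (A B : Ty T) : Arr (.prod A (.arr A B)) B

/-- The congruence on formal arrows generated by the equations of cartesian closed categories. -/
inductive ArrEq {T : Type u} : ∀ {A B : Ty T}, Arr A B → Arr A B → Prop
  | refl {A B : Ty T} (f : Arr A B) : ArrEq f f
  | symm {A B : Ty T} {f g : Arr A B} : ArrEq f g → ArrEq g f
  | trans {A B : Ty T} {f g h : Arr A B} : ArrEq f g → ArrEq g h → ArrEq f h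
  | comp_congr {A B C : Ty T} {f f' : Arr A B} {g g' : Arr B C} :
      ArrEq f f' → ArrEq g g' → ArrEq (f.comp g) (f'.comp g')
  | lift_congr {X A B : Ty T} {f f' : Arr X A} {g g' : Arr X B} :
      ArrEq f f' → ArrEq g g' → ArrEq (f.lift g) (f'.lift g')
  | curry_congr {X A B : Ty T} {f f' : Arr (.prod A X) B} :
      ArrEq f f' → ArrEq f.curry f'.curry
  | id_comp {A B : Ty T} (f : Arr A B) : ArrEq ((Arr.id A).comp f) f
  | comp_id {A B : Ty T} (f : Arr A B) : ArrEq (f.comp (.id B)) f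
  | assoc {A B C D : Ty T} (f : Arr A B) (g : Arr B C) (h : Arr C D) :
      ArrEq ((f.comp g).comp h) (f.comp (g.comp h))
  | toUnit_uniq {A : Ty T} (f : Arr A .unit) : ArrEq f (.toUnit A)
  | lift_fst {X A B : Ty T} (f : Arr X A) (g : Arr X B) : ArrEq ((f.lift g).comp (.fst A B)) f
  | lift_snd {X A B : Ty T} (f : Arr X A) (g : Arr X B) : ArrEq ((f.lift g).comp (.snd A B)) g
  | lift_uniq {X A B : Ty T} (h : Arr X (.prod A B)) :
      ArrEq ((h.comp (.fst A B)).lift (h.comp (.snd A B))) h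
  | curry_ev {X A B : Ty T} (f : Arr (.prod A X) B) :
      ArrEq (((Arr.fst A X).lift ((Arr.snd A X).comp f.curry)).comp (.ev A B)) f
  | curry_uniq {X A B : Ty T} (g : Arr X (.arr A B)) :
      ArrEq (Arr.curry (((Arr.fst A X).lift ((Arr.snd A X).comp g)).comp (.ev A B))) g

/-- Formal arrows modulo the equations of cartesian closed categories. -/
def arrSetoid {T : Type u} (A B : Ty T) : Setoid (Arr A B) where
  r := ArrEq
  iseqv := ⟨.refl, .symm, .trans⟩

/-- The free cartesian closed category on the set `T`: its objects are the simple types over `T`,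
and its morphisms are formal arrows modulo the equations of cartesian closed categories. -/
structure FreeCCC (T : Type u) : Type u where
  ty : Ty T

namespace FreeCCC

variable {T : Type u}

instance : SmallCategory (FreeCCC T) where
  Hom A B := Quotient (arrSetoid A.ty B.ty)
  id A := Quotient.mk _ (.id A.ty)
  comp f g := Quotient.map₂ Arr.comp (fun _ _ h _ _ h' => ArrEq.comp_congr h h') f g
  id_comp f := by
    induction f using Quotient.ind
    exact Quotient.sound (ArrEq.id_comp _)
  comp_id f := by
    induction f using Quotient.ind
    exact Quotient.sound (ArrEq.comp_id _)
  assoc f g h := by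
    induction f using Quotient.ind
    induction g using Quotient.ind
    induction h using Quotient.ind
    exact Quotient.sound (ArrEq.assoc _ _ _)

/-- The morphism represented by a formal arrow. -/
def homMk {A B : FreeCCC T} (f : Arr A.ty B.ty) : A ⟶ B := Quotient.mk _ f

/-- The terminal object. -/
abbrev one : FreeCCC T := ⟨.unit⟩

/-- Binary products. -/
abbrev prod (A B : FreeCCC T) : FreeCCC T := ⟨.prod A.ty B.ty⟩

/-- Exponentials. -/
abbrev exp (A B : FreeCCC T) : FreeCCC T := ⟨.arr A.ty B.ty⟩

/-- First projection. -/
def prodFst (A B : FreeCCC T) : prod A B ⟶ A := homMk (.fst _ _)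

/-- Second projection. -/
def prodSnd (A B : FreeCCC T) : prod A B ⟶ B := homMk (.snd _ _)

/-- Pairing. -/
def prodLift {X A B : FreeCCC T} (f : X ⟶ A) (g : X ⟶ B) : X ⟶ prod A B :=
  Quotient.map₂ (sa := arrSetoid X.ty A.ty) (sb := arrSetoid X.ty B.ty)
    (sc := arrSetoid X.ty (.prod A.ty B.ty)) Arr.lift
    (fun _ _ h _ _ h' => ArrEq.lift_congr h h') f g

theorem prodLift_fst {X A B : FreeCCC T} (f : X ⟶ A) (g : X ⟶ B) :
    prodLift f g ≫ prodFst A B = f := by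
  induction f using Quotient.ind
  induction g using Quotient.ind
  exact Quotient.sound (ArrEq.lift_fst _ _)

theorem prodLift_snd {X A B : FreeCCC T} (f : X ⟶ A) (g : X ⟶ B) :
    prodLift f g ≫ prodSnd A B = g := by
  induction f using Quotient.ind
  induction g using Quotient.ind
  exact Quotient.sound (ArrEq.lift_snd _ _)

theorem prodLift_uniq {X A B : FreeCCC T} (h : X ⟶ prod A B) :
    prodLift (h ≫ prodFst A B) (h ≫ prodSnd A B) = h := by
  induction h using Quotient.ind
  exact Quotient.sound (ArrEq.lift_uniq _)

/-- The cartesian structure of the free cartesian closed category. -/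
instance : CartesianMonoidalCategory (FreeCCC T) :=
  .ofChosenFiniteProducts
    ⟨Limits.asEmptyCone one, Limits.IsTerminal.ofUniqueHom (fun A => homMk (.toUnit A.ty))
      fun A f => by
        induction f using Quotient.ind
        exact Quotient.sound (ArrEq.toUnit_uniq _)⟩
    fun A B => ⟨Limits.BinaryFan.mk (prodFst A B) (prodSnd A B),
      Limits.BinaryFan.IsLimit.mk _ (fun f g => prodLift f g) prodLift_fst prodLift_snd
        fun f g m hf hg => by
          subst hf hg
          exact (prodLift_uniq m).symm⟩

/-- Evaluation. -/
def expEv (A B : FreeCCC T) : A ⊗ exp A B ⟶ B := homMk (.ev A.ty B.ty)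

/-- Transposition. -/
def expCurry {X A B : FreeCCC T} (f : A ⊗ X ⟶ B) : X ⟶ exp A B :=
  Quotient.map (sa := arrSetoid (.prod A.ty X.ty) B.ty) (sb := arrSetoid X.ty (.arr A.ty B.ty))
    Arr.curry (fun _ _ h => ArrEq.curry_congr h) f

theorem lift_eq {X A B : FreeCCC T} (f : X ⟶ A) (g : X ⟶ B) :
    CartesianMonoidalCategory.lift f g = prodLift f g := rfl

theorem whiskerLeft_eq (A : FreeCCC T) {X Y : FreeCCC T} (f : X ⟶ Y) :
    A ◁ f = prodLift (fst A X) (snd A X ≫ f) := by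
  rw [← lift_eq]
  apply CartesianMonoidalCategory.hom_ext <;> simp

theorem expCurry_ev {X A B : FreeCCC T} (f : A ⊗ X ⟶ B) : A ◁ expCurry f ≫ expEv A B = f := by
  rw [whiskerLeft_eq]
  induction f using Quotient.ind
  exact Quotient.sound (ArrEq.curry_ev _)

theorem expCurry_uniq {X A B : FreeCCC T} (g : X ⟶ exp A B) :
    expCurry (A ◁ g ≫ expEv A B) = g := by
  rw [whiskerLeft_eq]
  induction g using Quotient.ind
  exact Quotient.sound (ArrEq.curry_uniq _)

/-- Morphisms `A ⊗ X ⟶ B` correspond to morphisms `X ⟶ exp A B`. -/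
def expEquiv (A X B : FreeCCC T) : ((tensorLeft A).obj X ⟶ B) ≃ (X ⟶ exp A B) where
  toFun f := expCurry f
  invFun g := A ◁ g ≫ expEv A B
  left_inv := expCurry_ev
  right_inv := expCurry_uniq

theorem expEquiv_naturality (A X' X B : FreeCCC T) (f : X' ⟶ X) (g : (tensorLeft A).obj X ⟶ B) :
    expEquiv A X' B ((tensorLeft A).map f ≫ g) = f ≫ expEquiv A X B g := by
  apply (expEquiv A X' B).symm.injective
  rw [Equiv.symm_apply_apply]
  change A ◁ f ≫ g = A ◁ (f ≫ expCurry g) ≫ expEv A B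
  rw [MonoidalCategory.whiskerLeft_comp, Category.assoc, expCurry_ev]

/-- The free cartesian closed category is cartesian closed. -/
instance : MonoidalClosed (FreeCCC T) where
  closed A :=
    { rightAdj := Adjunction.rightAdjointOfEquiv (F := tensorLeft A) (expEquiv A)
        (expEquiv_naturality A)
      adj := Adjunction.adjunctionOfEquivRight (F := tensorLeft A) (expEquiv A)
        (expEquiv_naturality A) }

/-- The universal interpretation of base types in the free cartesian closed category. -/
def of (b : T) : FreeCCC T := ⟨.base b⟩

end FreeCCC

end Free

/-! ### Glueing along the nerve functor -/

section Glueing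

variable {K : Type u} [SmallCategory K] {S : Type w} [Category.{v} S]

/-- Objects `(P, p, A)` of the glueing category along the nerve functor
`A ↦ Hom (ς (-), A)` induced by `ς : Kᵒᵖ ⥤ S`: a (covariant) presheaf `P` on `K`, an object `A`
of `S` and a natural transformation `p : P ⟶ Hom (ς (-), A)`. -/
structure Glue (ς : Kᵒᵖ ⥤ S) where
  P : K ⥤ Type (max u v)
  A : S
  p : ∀ c : K, P.obj c → (ς.obj (op c) ⟶ A)
  p_map : ∀ {c d : K} (ρ : c ⟶ d) (a : P.obj c), p d (P.map ρ a) = ς.map ρ.op ≫ p c a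

namespace Glue

/-- Morphisms of glued objects: pairs `(φ, f)` making the evident square commute. -/
@[ext]
structure Hom {ς : Kᵒᵖ ⥤ S} (X Y : Glue ς) where
  φ : X.P ⟶ Y.P
  f : X.A ⟶ Y.A
  comm : ∀ (c : K) (a : X.P.obj c), Y.p c (φ.app c a) = X.p c a ≫ f

/-- The glueing category. -/
instance (ς : Kᵒᵖ ⥤ S) : Category (Glue ς) where
  Hom := Hom
  id X := ⟨𝟙 X.P, 𝟙 X.A, fun c a => (Category.comp_id _).symm⟩
  comp g h := ⟨g.φ ≫ h.φ, g.f ≫ h.f, fun c a => by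
    rw [← Category.assoc, ← g.comm]
    exact h.comm c _⟩
  id_comp g := Hom.ext (Category.id_comp _) (Category.id_comp _)
  comp_id g := Hom.ext (Category.comp_id _) (Category.comp_id _)
  assoc g h k := Hom.ext (Category.assoc _ _ _) (Category.assoc _ _ _)

variable {ς : Kᵒᵖ ⥤ S}

theorem hom_ext {X Y : Glue ς} {g h : X ⟶ Y}
    (h₁ : ∀ (c : K) (a : X.P.obj c), g.φ.app c a = h.φ.app c a) (h₂ : g.f = h.f) : g = h := by
  apply Hom.ext _ h₂
  ext c a
  exact h₁ c a

theorem map_id_apply (X : Glue ς) (c : K) (a : X.P.obj c) : X.P.map (𝟙 c) a = a := by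
  rw [X.P.map_id]
  rfl

theorem map_comp_apply (X : Glue ς) {c d e : K} (ρ : c ⟶ d) (ρ' : d ⟶ e) (a : X.P.obj c) :
    X.P.map (ρ ≫ ρ') a = X.P.map ρ' (X.P.map ρ a) := by
  rw [X.P.map_comp]
  rfl

theorem φ_map {X Y : Glue ς} (g : X ⟶ Y) {c d : K} (ρ : c ⟶ d) (a : X.P.obj c) :
    g.φ.app d (X.P.map ρ a) = Y.P.map ρ (g.φ.app c a) :=
  ConcreteCategory.congr_hom (g.φ.naturality ρ) a

variable [CartesianMonoidalCategory S]

/-- The terminal glued object. -/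
def one (ς : Kᵒᵖ ⥤ S) : Glue ς where
  P := (Functor.const K).obj PUnit
  A := 𝟙_ S
  p _ _ := toUnit _
  p_map _ _ := toUnit_unique _ _

/-- The product of two glued objects. -/
def prod (X Y : Glue ς) : Glue ς where
  P :=
    { obj := fun c => X.P.obj c × Y.P.obj c
      map := fun ρ => ↾fun a => (X.P.map ρ a.1, Y.P.map ρ a.2)
      map_id := fun c => by
        ext a
        · exact X.map_id_apply c a.1
        · exact Y.map_id_apply c a.2
      map_comp := fun ρ ρ' => by
        ext a
        · exact X.map_comp_apply ρ ρ' a.1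
        · exact Y.map_comp_apply ρ ρ' a.2 }
  A := X.A ⊗ Y.A
  p c a := lift (X.p c a.1) (Y.p c a.2)
  p_map ρ a := by
    rw [comp_lift, ← X.p_map, ← Y.p_map]
    rfl

/-- First projection. -/
def prodFst (X Y : Glue ς) : prod X Y ⟶ X where
  φ := { app := fun c => ↾fun a => a.1 }
  f := fst _ _
  comm _ _ := (lift_fst _ _).symm

/-- Second projection. -/
def prodSnd (X Y : Glue ς) : prod X Y ⟶ Y where
  φ := { app := fun c => ↾fun a => a.2 }
  f := snd _ _
  comm _ _ := (lift_snd _ _).symm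

/-- Pairing. -/
def prodLift {Z X Y : Glue ς} (g : Z ⟶ X) (h : Z ⟶ Y) : Z ⟶ prod X Y where
  φ :=
    { app := fun c => ↾fun a => (g.φ.app c a, h.φ.app c a)
      naturality := fun c d ρ => by
        ext a
        exact Prod.ext (φ_map g ρ a) (φ_map h ρ a) }
  f := lift g.f h.f
  comm c a := by
    refine Eq.trans ?_ (comp_lift (Z.p c a) g.f h.f).symm
    rw [← g.comm, ← h.comm]
    rfl

/-- The unique map to the terminal glued object. -/
def toOne (X : Glue ς) : X ⟶ one ς where
  φ := { app := fun c => ↾fun _ => PUnit.unit }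
  f := toUnit _
  comm _ _ := toUnit_unique _ _

/-- The cartesian structure of the glueing category. -/
instance : CartesianMonoidalCategory (Glue ς) :=
  .ofChosenFiniteProducts
    ⟨Limits.asEmptyCone (one ς), Limits.IsTerminal.ofUniqueHom toOne
      fun X g => hom_ext (fun _ _ => rfl) (toUnit_unique _ _)⟩
    fun X Y => ⟨Limits.BinaryFan.mk (prodFst X Y) (prodSnd X Y),
      Limits.BinaryFan.IsLimit.mk _ (fun f g => prodLift f g)
        (fun g h => hom_ext (fun _ _ => rfl) (lift_fst _ _))
        (fun g h => hom_ext (fun _ _ => rfl) (lift_snd _ _))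
        fun g h m hg hh => by
          subst hg hh
          exact hom_ext (fun _ _ => rfl) (lift_comp_fst_snd _).symm⟩

theorem whiskerLeft_eq (X : Glue ς) {Y Z : Glue ς} (g : Y ⟶ Z) :
    X ◁ g = prodLift (prodFst X Y) (prodSnd X Y ≫ g) :=
  CartesianMonoidalCategory.hom_ext _ _
    ((whiskerLeft_fst X g).trans (lift_fst (prodFst X Y) (prodSnd X Y ≫ g)).symm)
    ((whiskerLeft_snd X g).trans (lift_snd (prodFst X Y) (prodSnd X Y ≫ g)).symm)

variable [MonoidalClosed S]

theorem lift_curry_ev {W' W A B : S} (a : W' ⟶ A) (b : W' ⟶ W) (g : A ⊗ W ⟶ B) :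
    lift a (b ≫ MonoidalClosed.curry g) ≫ (ihom.ev A).app B = lift a b ≫ g := by
  rw [← lift_whiskerLeft, Category.assoc, MonoidalClosed.whiskerLeft_curry_ihom_ev_app]

theorem curry_lift_ev {W A B : S} (h : W ⟶ (ihom A).obj B) :
    MonoidalClosed.curry (lift (fst A W) (snd A W ≫ h) ≫ (ihom.ev A).app B) = h := by
  rw [← lift_whiskerLeft, lift_fst_snd, Category.id_comp, ← MonoidalClosed.uncurry_eq,
    MonoidalClosed.curry_uncurry]

/-- Elements at stage `c` of the exponential of the glued objects `X` and `Y`: pairs of a morphism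
`f : ς c ⟶ (X.A ⟹ Y.A)` and a natural transformation `φ : y c × X.P ⟶ Y.P` lying over it. -/
@[ext]
structure ExpEl (X Y : Glue ς) (c : K) : Type (max u v) where
  f : ς.obj (op c) ⟶ (ihom X.A).obj Y.A
  φ : ∀ d : K, (c ⟶ d) → X.P.obj d → Y.P.obj d
  φ_map : ∀ {d e : K} (ρ : c ⟶ d) (ρ' : d ⟶ e) (a : X.P.obj d),
    φ e (ρ ≫ ρ') (X.P.map ρ' a) = Y.P.map ρ' (φ d ρ a)
  comm : ∀ (d : K) (ρ : c ⟶ d) (a : X.P.obj d),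
    Y.p d (φ d ρ a) = lift (X.p d a) (ς.map ρ.op ≫ f) ≫ (ihom.ev X.A).app Y.A

/-- The presheaf action on exponentials. -/
def ExpEl.map {X Y : Glue ς} {c d : K} (σ : c ⟶ d) (r : ExpEl X Y c) : ExpEl X Y d where
  f := ς.map σ.op ≫ r.f
  φ e ρ a := r.φ e (σ ≫ ρ) a
  φ_map ρ ρ' a := by rw [← Category.assoc, r.φ_map]
  comm e ρ a := by rw [r.comm, op_comp, ς.map_comp, Category.assoc]

theorem ExpEl.map_id {X Y : Glue ς} {c : K} (r : ExpEl X Y c) : r.map (𝟙 c) = r := by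
  refine ExpEl.ext ?_ ?_
  · simp [ExpEl.map]
  · simp [ExpEl.map]

theorem ExpEl.map_comp {X Y : Glue ς} {c d e : K} (σ : c ⟶ d) (σ' : d ⟶ e) (r : ExpEl X Y c) :
    r.map (σ ≫ σ') = (r.map σ).map σ' := by
  refine ExpEl.ext ?_ ?_
  · simp [ExpEl.map]
  · simp [ExpEl.map]

/-- The exponential of two glued objects. -/
def exp (X Y : Glue ς) : Glue ς where
  P :=
    { obj := fun c => ExpEl X Y c
      map := fun σ => TypeCat.ofHom (ExpEl.map σ)
      map_id := fun _ => ConcreteCategory.hom_ext _ _ ExpEl.map_id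
      map_comp := fun σ σ' => ConcreteCategory.hom_ext _ _ (ExpEl.map_comp σ σ') }
  A := (ihom X.A).obj Y.A
  p _ r := r.f
  p_map _ _ := rfl

/-- Evaluation. -/
def expEv (X Y : Glue ς) : X ⊗ exp X Y ⟶ Y where
  φ :=
    { app := fun c => ↾fun (a : X.P.obj c × ExpEl X Y c) => a.2.φ c (𝟙 c) a.1
      naturality := fun c d ρ => by
        ext (a : X.P.obj c × ExpEl X Y c)
        change a.2.φ d (ρ ≫ 𝟙 d) (X.P.map ρ a.1) = Y.P.map ρ (a.2.φ c (𝟙 c) a.1)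
        rw [← a.2.φ_map, Category.comp_id, Category.id_comp] }
  f := (ihom.ev X.A).app Y.A
  comm c a := by
    refine (ExpEl.comm _ c (𝟙 c) _).trans ?_
    rw [op_id, ς.map_id, Category.id_comp]
    rfl

/-- Transposition. -/
def expCurry {Z X Y : Glue ς} (g : X ⊗ Z ⟶ Y) : Z ⟶ exp X Y where
  φ :=
    { app := fun c => ↾fun z =>
        { f := Z.p c z ≫ MonoidalClosed.curry g.f
          φ := fun d ρ a => g.φ.app d (show X.P.obj d × Z.P.obj d from (a, Z.P.map ρ z))
          φ_map := fun {d e} ρ ρ' a => by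
            refine Eq.trans ?_ (φ_map g ρ' (show X.P.obj d × Z.P.obj d from (a, Z.P.map ρ z)))
            rw [Z.map_comp_apply]
            rfl
          comm := fun d ρ a => by
            refine (g.comm d (show X.P.obj d × Z.P.obj d from (a, Z.P.map ρ z))).trans ?_
            change lift (X.p d a) (Z.p d (Z.P.map ρ z)) ≫ g.f = _
            rw [Z.p_map, ← Category.assoc (ς.map ρ.op)]
            exact (lift_curry_ev _ _ _).symm }
      naturality := fun c d σ => by
        ext z
        refine ExpEl.ext ?_ ?_
        · change Z.p d (Z.P.map σ z) ≫ _ = ς.map σ.op ≫ Z.p c z ≫ _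
          rw [Z.p_map, Category.assoc]
        · funext e ρ a
          change g.φ.app e (show X.P.obj e × Z.P.obj e from (a, Z.P.map ρ (Z.P.map σ z))) =
            g.φ.app e (show X.P.obj e × Z.P.obj e from (a, Z.P.map (σ ≫ ρ) z))
          rw [Z.map_comp_apply] }
  f := MonoidalClosed.curry g.f
  comm _ _ := rfl

theorem expCurry_ev {Z X Y : Glue ς} (g : X ⊗ Z ⟶ Y) : X ◁ expCurry g ≫ expEv X Y = g := by
  rw [whiskerLeft_eq]
  refine hom_ext ?_ ?_
  · intro c a
    change g.φ.app c (show X.P.obj c × Z.P.obj c from (a.1, Z.P.map (𝟙 c) a.2)) = g.φ.app c a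
    rw [Z.map_id_apply]
    rfl
  · change lift (fst X.A Z.A) (snd X.A Z.A ≫ MonoidalClosed.curry g.f) ≫
      (ihom.ev X.A).app Y.A = g.f
    refine (lift_curry_ev _ _ _).trans ?_
    rw [lift_fst_snd]
    exact Category.id_comp _

theorem expCurry_uniq {Z X Y : Glue ς} (h : Z ⟶ exp X Y) : expCurry (X ◁ h ≫ expEv X Y) = h := by
  rw [whiskerLeft_eq]
  have hf : (expCurry (prodLift (prodFst X Z) (prodSnd X Z ≫ h) ≫ expEv X Y)).f  = h.f :=
    curry_lift_ev (A := X.A) (B := Y.A) h.f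
  refine hom_ext ?_ hf
  intro c z
  refine ExpEl.ext ?_ ?_
  · refine Eq.trans ?_ (h.comm c z).symm
    rw [← hf]
    rfl
  · funext d ρ a
    change (h.φ.app d (Z.P.map ρ z)).φ d (𝟙 d) a = (h.φ.app c z).φ d ρ a
    rw [φ_map]
    change (h.φ.app c z).φ d (ρ ≫ 𝟙 d) a = _
    rw [Category.comp_id]

/-- Morphisms `X ⊗ Z ⟶ Y` correspond to morphisms `Z ⟶ exp X Y`. -/
def expEquiv (X Z Y : Glue ς) : ((tensorLeft X).obj Z ⟶ Y) ≃ (Z ⟶ exp X Y) where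
  toFun g := expCurry g
  invFun h := X ◁ h ≫ expEv X Y
  left_inv := expCurry_ev
  right_inv := expCurry_uniq

theorem expEquiv_naturality (X Z' Z Y : Glue ς) (g : Z' ⟶ Z) (h : (tensorLeft X).obj Z ⟶ Y) :
    expEquiv X Z' Y ((tensorLeft X).map g ≫ h) = g ≫ expEquiv X Z Y h := by
  apply (expEquiv X Z' Y).symm.injective
  rw [Equiv.symm_apply_apply]
  change X ◁ g ≫ h = X ◁ (g ≫ expCurry h) ≫ expEv X Y
  rw [MonoidalCategory.whiskerLeft_comp, Category.assoc, expCurry_ev]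

/-- The glueing category is cartesian closed. -/
instance : MonoidalClosed (Glue ς) where
  closed X :=
    { rightAdj := Adjunction.rightAdjointOfEquiv (F := tensorLeft X) (expEquiv X)
        (expEquiv_naturality X)
      adj := Adjunction.adjunctionOfEquivRight (F := tensorLeft X) (expEquiv X)
        (expEquiv_naturality X) }

end Glue

end Glueing

/-! ### Normalisation by evaluation -/

section Normalisation

variable {T : Type u} {S : Type w} [Category.{v} S] [CartesianMonoidalCategory S]
  [MonoidalClosed S]

/-- The glueing category along the nerve of the interpretation of contexts induced by `s`. -/
abbrev GlueCat (s : T → S) : Type (max (u + 1) (v + 1) w) := Glue (ctxSem s)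

/-- The embedding of contexts in the glueing category, on objects:
the representable presheaf on `Γ` over the interpretation of `Γ`. -/
def yonObj (s : T → S) (Γ : Ctx T) : GlueCat s where
  P := coyoneda.obj (op Γ) ⋙ uliftFunctor.{v}
  A := ctxProd (tySem s) Γ
  p _ ρ := (ctxSem s).map ρ.down.op
  p_map ρ ρ' := (ctxSem s).map_comp ρ.op ρ'.down.op

/-- The glued object of variables of type `τ`. -/
def varObj (s : T → S) (τ : Ty T) : GlueCat s where
  P := varPsh τ ⋙ uliftFunctor.{v}
  A := tySem s τ
  p _ x := ctxProj (tySem s) x.down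
  p_map ρ x := (ctxRen_proj (tySem s) ρ x.down).symm

/-- The glued object of neutral terms of type `τ` and their semantics. -/
def neObj (s : T → S) (τ : Ty T) : GlueCat s where
  P := nePsh τ ⋙ uliftFunctor.{v}
  A := tySem s τ
  p _ M := tmSem s M.down.1
  p_map ρ M := tmSem_rename s M.down.1 ρ

/-- The glued object of normal terms of type `τ` and their semantics. -/
def nfObj (s : T → S) (τ : Ty T) : GlueCat s where
  P := nfPsh τ ⋙ uliftFunctor.{v}
  A := tySem s τ
  p _ N := tmSem s N.down.1
  p_map ρ N := tmSem_rename s N.down.1 ρ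

/-- `(var, id)`, from variables to neutral terms. -/
def varMap (s : T → S) (τ : Ty T) : varObj s τ ⟶ neObj s τ where
  φ := { app := fun Γ => ↾fun x => ⟨⟨.var x.down, .var _⟩⟩ }
  f := 𝟙 (tySem s τ)
  comm _ _ := (Category.comp_id _).symm

/-- `(fst, π₁)` on neutral terms. -/
def fstMap (s : T → S) (σ τ : Ty T) : neObj s (.prod σ τ) ⟶ neObj s σ where
  φ := { app := fun Γ => ↾fun M => ⟨⟨.fst M.down.1, .fst M.down.2⟩⟩ }
  f := fst (tySem s σ) (tySem s τ)
  comm _ _ := rfl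

/-- `(snd, π₂)` on neutral terms. -/
def sndMap (s : T → S) (σ τ : Ty T) : neObj s (.prod σ τ) ⟶ neObj s τ where
  φ := { app := fun Γ => ↾fun M => ⟨⟨.snd M.down.1, .snd M.down.2⟩⟩ }
  f := snd (tySem s σ) (tySem s τ)
  comm _ _ := rfl

/-- `(app, ε)`, applying neutral terms to normal terms. -/
def appMap (s : T → S) (σ τ : Ty T) : nfObj s σ ⊗ neObj s (.arr σ τ) ⟶ neObj s τ where
  φ :=
    { app := fun Γ => ↾fun (a : ULift.{v} (Nf Γ σ) × ULift.{v} (Ne Γ (.arr σ τ))) =>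
        ⟨⟨.app a.2.down.1 a.1.down.1, .app a.2.down.2 a.1.down.2⟩⟩ }
  f := (ihom.ev (tySem s σ)).app (tySem s τ)
  comm _ _ := rfl

/-- Neutral terms of base type are normal. -/
def normMap (s : T → S) (b : T) : neObj s (.base b) ⟶ nfObj s (.base b) where
  φ := { app := fun Γ => ↾fun M => ⟨⟨M.down.1, .base M.down.2⟩⟩ }
  f := 𝟙 (s b)
  comm _ _ := (Category.comp_id _).symm

/-- `(unit, id)` on normal terms. -/
def unitMap (s : T → S) : 𝟙_ (GlueCat s) ⟶ nfObj s .unit where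
  φ := { app := fun Γ => ↾fun _ => ⟨⟨.unit, .unit⟩⟩ }
  f := 𝟙 (𝟙_ S)
  comm _ _ := toUnit_unique _ _

/-- `(pair, id)` on normal terms. -/
def pairMap (s : T → S) (σ τ : Ty T) : nfObj s σ ⊗ nfObj s τ ⟶ nfObj s (.prod σ τ) where
  φ :=
    { app := fun Γ => ↾fun (a : ULift.{v} (Nf Γ σ) × ULift.{v} (Nf Γ τ)) =>
        ⟨⟨.pair a.1.down.1 a.2.down.1, .pair a.1.down.2 a.2.down.2⟩⟩ }
  f := 𝟙 (tySem s σ ⊗ tySem s τ)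
  comm _ _ := (Category.comp_id _).symm

/-- The element of `nfPsh τ` in the context `Γ, x : σ` that represents an element at stage `Γ` of
the exponential of `nfObj s τ` by `varObj s σ`, obtained by evaluation at the fresh variable. -/
def expBody (s : T → S) {σ τ : Ty T} {Γ : Ctx T} (r : Glue.ExpEl (varObj s σ) (nfObj s τ) Γ) :
    Nf (Γ.ext σ) τ :=
  (r.φ (Γ.ext σ) (Ren.wk Γ σ) ⟨Var.zero⟩).down

/-- `(abs, id)`, from the exponential of normal terms by variables to normal terms. -/
def absMap (s : T → S) (σ τ : Ty T) :
    (ihom (varObj s σ)).obj (nfObj s τ) ⟶ nfObj s (.arr σ τ) where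
  φ :=
    { app := fun Γ => ↾fun (r : Glue.ExpEl (varObj s σ) (nfObj s τ) Γ) =>
        ⟨⟨.lam (expBody s r).1, .lam (expBody s r).2⟩⟩
      naturality := fun Γ Δ ρ => by
        ext (r : Glue.ExpEl (varObj s σ) (nfObj s τ) Γ)
        apply congrArg ULift.up
        apply Subtype.ext
        apply congrArg Tm.lam
        have h := r.φ_map (Ren.wk Γ σ) (Ren.lift σ ρ) ⟨Var.zero⟩
        exact congrArg (fun N => N.down.1) h }
  f := 𝟙 ((ihom (tySem s σ)).obj (tySem s τ))
  comm Γ (r : Glue.ExpEl (varObj s σ) (nfObj s τ) Γ) := by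
    refine Eq.trans ?_ (Category.comp_id _).symm
    refine Eq.trans ?_ (Glue.curry_lift_ev (A := tySem s σ) (B := tySem s τ) r.f)
    apply congrArg MonoidalClosed.curry
    refine (r.comm (Γ.ext σ) (Ren.wk Γ σ) ⟨Var.zero⟩).trans ?_
    change lift (fst _ _) (ctxRen (tySem s) (Ren.wk Γ σ) ≫ r.f) ≫ _ = _
    rw [ctxRen_wk]
    rfl

/-- The interpretation of base types in the glueing category by neutral terms. -/
def glueInterp (s : T → S) (b : T) : GlueCat s := neObj s (.base b)

/-- The unquote and quote maps. -/
def unquoteQuote (s : T → S) : ∀ τ : Ty T,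
    (neObj s τ ⟶ tySem (glueInterp s) τ) × (tySem (glueInterp s) τ ⟶ nfObj s τ)
  | .base b => (𝟙 (neObj s (.base b)), normMap s b)
  | .unit => (toUnit _, unitMap s)
  | .prod σ τ =>
      (lift (fstMap s σ τ ≫ (unquoteQuote s σ).1) (sndMap s σ τ ≫ (unquoteQuote s τ).1),
       ((unquoteQuote s σ).2 ⊗ₘ (unquoteQuote s τ).2) ≫ pairMap s σ τ)
  | .arr σ τ =>
      (MonoidalClosed.curry
        ((unquoteQuote s σ).2 ▷ neObj s (.arr σ τ) ≫ appMap s σ τ ≫ (unquoteQuote s τ).1),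
       (MonoidalClosed.pre (varMap s σ ≫ (unquoteQuote s σ).1)).app _ ≫
         (ihom (varObj s σ)).map (unquoteQuote s τ).2 ≫ absMap s σ τ)

/-- The unquote map. -/
def unquote (s : T → S) (τ : Ty T) : neObj s τ ⟶ tySem (glueInterp s) τ := (unquoteQuote s τ).1

/-- The quote map. -/
def quote (s : T → S) (τ : Ty T) : tySem (glueInterp s) τ ⟶ nfObj s τ := (unquoteQuote s τ).2

/-- The map from the glued representable on `Γ` to variables of type `τ` given by a variable. -/
def yonProj (s : T → S) {Γ : Ctx T} {τ : Ty T} (x : Var Γ τ) : yonObj s Γ ⟶ varObj s τ where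
  φ := { app := fun Δ => ↾fun ρ => ⟨ρ.down.app x⟩ }
  f := ctxProj (tySem s) x
  comm _ ρ := (ctxRen_proj (tySem s) ρ.down x).symm

/-- The map from the glued representable on `Γ` to the product of neutral terms over `Γ`. -/
def varCtx (s : T → S) (Γ : Ctx T) : yonObj s Γ ⟶ ctxProd (neObj s) Γ :=
  ctxLift (varObj s) (fun _ x => yonProj s x) ≫ ctxMap (varMap s) Γ

/-- The unquote map on contexts. -/
def unquoteCtx (s : T → S) (Γ : Ctx T) :
    ctxProd (neObj s) Γ ⟶ ctxProd (tySem (glueInterp s)) Γ :=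
  ctxMap (unquote s) Γ

/-- The morphism `quote ∘ ⟦t⟧ ∘ unquote ∘ var` in the glueing category. -/
def nfHom (s : T → S) {Γ : Ctx T} {τ : Ty T} (t : Tm Γ τ) : yonObj s Γ ⟶ nfObj s τ :=
  varCtx s Γ ≫ unquoteCtx s Γ ≫ tmSem (glueInterp s) t ≫ quote s τ

/-- The functorial action of the embedding of contexts in the glueing category. -/
def yonMap (s : T → S) {Γ Δ : Ctx T} (ρ : Γ ⟶ Δ) : yonObj s Δ ⟶ yonObj s Γ where
  φ := { app := fun Θ => ↾fun ρ' => ⟨ρ ≫ ρ'.down⟩ }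
  f := ctxRen (tySem s) ρ
  comm _ ρ' := (ctxSem s).map_comp ρ'.down.op ρ.op

theorem yonMap_yonProj (s : T → S) {Γ Δ : Ctx T} (ρ : Γ ⟶ Δ) {τ : Ty T} (x : Var Γ τ) :
    yonMap s ρ ≫ yonProj s x = yonProj s (ρ.app x) :=
  Glue.hom_ext (fun _ _ => rfl) (ctxRen_proj _ ρ x)

theorem varCtx_unquoteCtx_proj (s : T → S) {Γ : Ctx T} {τ : Ty T} (x : Var Γ τ) :
    (varCtx s Γ ≫ unquoteCtx s Γ) ≫ ctxProj (tySem (glueInterp s)) x =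
      yonProj s x ≫ varMap s τ ≫ unquote s τ := by
  rw [Category.assoc, unquoteCtx, ctxMap, ctxLift_proj, varCtx, ctxMap, Category.assoc,
    ← Category.assoc (ctxLift (neObj s) _), ctxLift_proj, Category.assoc, ← Category.assoc,
    ctxLift_proj]

theorem nfHom_rename (s : T → S) {Γ Δ : Ctx T} {τ : Ty T} (ρ : Γ ⟶ Δ) (t : Tm Γ τ) :
    nfHom s (t.rename ρ) = yonMap s ρ ≫ nfHom s t := by
  have h : (varCtx s Δ ≫ unquoteCtx s Δ) ≫ ctxRen (tySem (glueInterp s)) ρ =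
      yonMap s ρ ≫ varCtx s Γ ≫ unquoteCtx s Γ := by
    apply ctxProd_hom_ext
    intro τ x
    rw [Category.assoc, ctxRen_proj, varCtx_unquoteCtx_proj, Category.assoc,
      varCtx_unquoteCtx_proj, ← Category.assoc (yonMap s ρ), yonMap_yonProj]
  rw [nfHom, nfHom, tmSem_rename, ← Category.assoc, Category.assoc (ctxRen _ ρ),
    ← Category.assoc _ (ctxRen _ ρ), h]
  simp only [Category.assoc]

/-- The value of a glued morphism out of the representable on `Γ` at the identity of `Γ`. -/
def evalId (s : T → S) {Γ : Ctx T} {τ : Ty T} (g : yonObj s Γ ⟶ nfObj s τ) : Nf Γ τ :=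
  (g.φ.app Γ ⟨𝟙 Γ⟩).down

theorem evalId_yonMap (s : T → S) {Γ Δ : Ctx T} {τ : Ty T} (ρ : Γ ⟶ Δ)
    (g : yonObj s Γ ⟶ nfObj s τ) :
    evalId s (yonMap s ρ ≫ g) = (nfPsh τ).map ρ (evalId s g) := by
  have h := congrArg ULift.down (Glue.φ_map g ρ ⟨𝟙 Γ⟩)
  refine Eq.trans ?_ h
  change (g.φ.app Δ ⟨ρ ≫ 𝟙 Δ⟩).down = (g.φ.app Δ ⟨𝟙 Γ ≫ ρ⟩).down
  rw [Category.comp_id, Category.id_comp]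

/-- The normalisation function induced by an interpretation `s` of base types in a cartesian
closed category, as a morphism of presheaves: it sends a term `t` in context `Γ` to the value at
the identity of `Γ` of the presheaf component of `quote ∘ ⟦t⟧ ∘ unquote ∘ var`. -/
def nf (s : T → S) (τ : Ty T) : tmPsh τ ⟶ nfPsh τ where
  app Γ := ↾fun t => evalId s (nfHom s t)
  naturality Γ Δ ρ := by
    ext t
    exact (congrArg (evalId s) (nfHom_rename s ρ t)).trans (evalId_yonMap s ρ (nfHom s t))

/-- The normal term that the normalisation function induced by `s` assigns to a term. -/
def normalise (s : T → S) {Γ : Ctx T} {τ : Ty T} (t : Tm Γ τ) : Nf Γ τ := (nf s τ).app Γ t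

end Normalisation

end NbE

-- For every interpretation `s`, the function `normalise s` has two properties that together
-- determine it: its value on `t` is `βη`-equal to `t` (`betaEta_normalise`), and every normal term
-- `βη`-equal to `t` is that value (`eq_normalise_of_betaEta`). Given these, the normal form
-- computed with `s` is a normal term `βη`-equal to `t`, so the second property for the universal
-- interpretation identifies the two results. No comparison between the semantic categories is
-- needed.
--
-- The second property combines invariance and fixed points. Invariance is soundness of
-- `βη`-equality in a cartesian closed category (`BetaEta.tmSem_eq`), applied to the glueing
-- category. Normal terms are fixed by a mutual induction: a neutral term evaluates, at the
-- environment of unquoted variables, to its own unquoting, and a normal term is recovered by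
-- quoting its value.
--
-- The first property uses the Kripke logical relation `Realises` between terms and elements of the
-- glued interpretation. Unquoting lands in the relation, quoting an element gives a term `βη`-equal
-- to any term related to it (`realises_reflect_and_reify`), and every term is related to its value
-- (`realises_subst_eval`).
--
-- Both inductions take place in the presheaf components, so the glued exponentials are first
-- described by their action on elements.

namespace NbE

/-! ### Substitution calculus -/

section Substitution

variable {T : Type u}

namespace Tm

/-- Simultaneous substitutions are determined by their values. -/
theorem sub_ext {Γ Δ : Ctx T} {θ θ' : ∀ τ : Ty T, Var Γ τ → Tm Δ τ}
    (h : ∀ τ x, θ τ x = θ' τ x) : θ = θ' :=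
  funext fun τ => funext (h τ)

theorem subst_rename {Γ Δ Θ : Ctx T} {τ : Ty T} (t : Tm Γ τ) (ρ : Γ ⟶ Δ)
    (θ : ∀ τ : Ty T, Var Δ τ → Tm Θ τ) :
    (t.rename ρ).subst θ = t.subst fun τ x => θ τ (ρ.app x) := by
  induction t generalizing Δ Θ with
  | var x => rfl
  | unit => rfl
  | fst t ih => simp only [rename, subst, ih]
  | snd t ih => simp only [rename, subst, ih]
  | pair t t' ih ih' => simp only [rename, subst, ih, ih']
  | app t t' ih ih' => simp only [rename, subst, ih, ih']
  | lam t ih =>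
    simp only [rename, subst, ih]
    congr 2
    apply sub_ext
    intro τ x
    cases x <;> rfl

theorem rename_subst {Γ Δ Θ : Ctx T} {τ : Ty T} (t : Tm Γ τ)
    (θ : ∀ τ : Ty T, Var Γ τ → Tm Δ τ) (ρ : Δ ⟶ Θ) :
    (t.subst θ).rename ρ = t.subst fun τ x => (θ τ x).rename ρ := by
  induction t generalizing Δ Θ with
  | var x => rfl
  | unit => rfl
  | fst t ih => simp only [rename, subst, ih]
  | snd t ih => simp only [rename, subst, ih]
  | pair t t' ih ih' => simp only [rename, subst, ih, ih']
  | app t t' ih ih' => simp only [rename, subst, ih, ih']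
  | lam t ih =>
    simp only [rename, subst, ih]
    congr 2
    apply sub_ext
    intro τ x
    cases x with
    | zero => rfl
    | succ x =>
      simp only [liftSub]
      rw [← rename_comp, ← rename_comp, Ren.wk_lift]

/-- Under a binder, the lifted substitutions compose because substitution commutes with weakening on
either side; this is where `subst_rename` and `rename_subst` enter. -/
theorem subst_subst {Γ Δ Θ : Ctx T} {τ : Ty T} (t : Tm Γ τ)
    (θ : ∀ τ : Ty T, Var Γ τ → Tm Δ τ) (θ' : ∀ τ : Ty T, Var Δ τ → Tm Θ τ) :
    (t.subst θ).subst θ' = t.subst fun τ x => (θ τ x).subst θ' := by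
  induction t generalizing Δ Θ with
  | var x => rfl
  | unit => rfl
  | fst t ih => simp only [subst, ih]
  | snd t ih => simp only [subst, ih]
  | pair t t' ih ih' => simp only [subst, ih, ih']
  | app t t' ih ih' => simp only [subst, ih, ih']
  | lam t ih =>
    simp only [subst, ih]
    congr 2
    apply sub_ext
    intro τ x
    cases x with
    | zero => rfl
    | succ x =>
      simp only [liftSub]
      rw [subst_rename, rename_subst]
      rfl

theorem subst_var {Γ : Ctx T} {τ : Ty T} (t : Tm Γ τ) : t.subst (fun _ x => .var x) = t := by
  induction t with
  | var x => rfl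
  | unit => rfl
  | fst t ih => simp only [subst, ih]
  | snd t ih => simp only [subst, ih]
  | pair t t' ih ih' => simp only [subst, ih, ih']
  | app t t' ih ih' => simp only [subst, ih, ih']
  | lam t ih =>
    simp only [subst]
    refine congrArg lam (Eq.trans ?_ ih)
    congr 1
    apply sub_ext
    intro τ x
    cases x <;> rfl

theorem rename_subst_single {Γ Δ : Ctx T} {σ τ : Ty T} (t : Tm (Γ.ext σ) τ) (a : Tm Γ σ)
    (ρ : Γ ⟶ Δ) :
    (t.subst (single a)).rename ρ = (t.rename (Ren.lift σ ρ)).subst (single (a.rename ρ)) := by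
  rw [rename_subst, subst_rename]
  congr 1
  apply sub_ext
  intro τ x
  cases x <;> rfl

/-- A simultaneous substitution extended by a term for the last variable. -/
def consSub {Γ Δ : Ctx T} {σ : Ty T} (a : Tm Δ σ) (θ : ∀ τ : Ty T, Var Γ τ → Tm Δ τ) :
    ∀ τ : Ty T, Var (Γ.ext σ) τ → Tm Δ τ
  | _, .zero => a
  | _, .succ x => θ _ x

/-- The left side is the `β`-reduct that appears when a substituted and renamed abstraction is
applied to `a`, as in the abstraction case of `realises_subst_eval`. -/
theorem subst_liftSub_rename_single {Γ Δ Θ : Ctx T} {σ τ : Ty T} (t : Tm (Γ.ext σ) τ)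
    (θ : ∀ τ : Ty T, Var Γ τ → Tm Δ τ) (ρ : Δ ⟶ Θ) (a : Tm Θ σ) :
    ((t.subst (liftSub σ θ)).rename (Ren.lift σ ρ)).subst (single a) =
      t.subst (consSub a fun τ x => (θ τ x).rename ρ) := by
  rw [subst_rename, subst_subst]
  congr 1
  apply sub_ext
  intro τ x
  cases x with
  | zero => rfl
  | succ x =>
    simp only [liftSub, consSub]
    rw [subst_rename]
    -- Renaming is rewritten as substitution of variables, so that both sides become one
    -- substitution into `θ _ x`.
    conv_rhs => rw [← subst_var ((θ _ x).rename ρ), subst_rename]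
    rfl

end Tm

theorem BetaEta.rename {Γ Δ : Ctx T} {τ : Ty T} {t t' : Tm Γ τ} (h : BetaEta t t') (ρ : Γ ⟶ Δ) :
    BetaEta (t.rename ρ) (t'.rename ρ) := by
  induction h generalizing Δ with
  | refl t => exact .refl _
  | symm _ ih => exact .symm (ih ρ)
  | trans _ _ ih ih' => exact .trans (ih ρ) (ih' ρ)
  | fst_congr _ ih => exact .fst_congr (ih ρ)
  | snd_congr _ ih => exact .snd_congr (ih ρ)
  | pair_congr _ _ ih ih' => exact .pair_congr (ih ρ) (ih' ρ)
  | app_congr _ _ ih ih' => exact .app_congr (ih ρ) (ih' ρ)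
  | lam_congr _ ih => exact .lam_congr (ih _)
  | beta_fst a b => exact .beta_fst _ _
  | beta_snd a b => exact .beta_snd _ _
  | beta_app t a =>
    rw [Tm.rename_subst_single]
    exact .beta_app _ _
  | eta_unit t => exact .eta_unit _
  | eta_pair t => exact .eta_pair _
  | @eta_lam _ σ _ t =>
    -- Renaming and then weakening agrees with weakening and then applying the lifted renaming, so
    -- this `η`-expansion is the renamed `η`-expansion of `t`.
    have h := BetaEta.eta_lam (t.rename ρ)
    rw [← Tm.rename_comp, ← Ren.wk_lift, Tm.rename_comp] at h
    exact h

end Substitution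

/-! ### Soundness of the semantics for `βη`-equality -/

section Soundness

variable {T : Type u} {C : Type w} [Category.{v} C] [CartesianMonoidalCategory C]

theorem ctxLift_ctxProj (D : Ty T → C) (Γ : Ctx T) :
    ctxLift D (fun _ x => ctxProj D x) = 𝟙 (ctxProd D Γ) := by
  apply ctxProd_hom_ext
  intro τ x
  rw [ctxLift_proj, Category.id_comp]

variable [MonoidalClosed C]

/-- Substitution is precomposition with the tuple of its values. In the abstraction case the lifted
substitution denotes that tuple whiskered by the type of the bound variable, and naturality of
currying finishes. -/
theorem tmSem_subst (s : T → C) {Γ Δ : Ctx T} {τ : Ty T} (t : Tm Γ τ)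
    (θ : ∀ τ : Ty T, Var Γ τ → Tm Δ τ) :
    tmSem s (t.subst θ) = ctxLift (tySem s) (fun τ x => tmSem s (θ τ x)) ≫ tmSem s t := by
  induction t generalizing Δ with
  | var x => exact (ctxLift_proj (tySem s) (fun τ x => tmSem s (θ τ x)) x).symm
  | unit => exact toUnit_unique _ _
  | fst t ih => simp only [Tm.subst, tmSem, ih, Category.assoc]
  | snd t ih => simp only [Tm.subst, tmSem, ih, Category.assoc]
  | pair t t' ih ih' => simp only [Tm.subst, tmSem, ih, ih', comp_lift]
  | app t t' ih ih' => simp only [Tm.subst, tmSem, ih, ih', comp_lift_assoc]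
  | @lam Γ σ τ t ih =>
    simp only [Tm.subst, tmSem, ih]
    refine Eq.trans ?_ (MonoidalClosed.curry_natural_left _ _)
    congr 2
    apply ctxProd_hom_ext
    intro τ x
    rw [ctxLift_proj]
    cases x with
    | zero => simp [Tm.liftSub, tmSem, ctxProj]
    | succ x =>
      simp only [Tm.liftSub, tmSem_rename, ctxRen_wk, ctxProj]
      rw [whiskerLeft_snd_assoc, ctxLift_proj]

theorem tmSem_subst_single (s : T → C) {Γ : Ctx T} {σ τ : Ty T} (t : Tm (Γ.ext σ) τ)
    (a : Tm Γ σ) :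
    tmSem s (t.subst (Tm.single a)) =
      lift (tmSem s a) (𝟙 (ctxProd (tySem s) Γ)) ≫ tmSem s t := by
  rw [tmSem_subst, ← ctxLift_ctxProj]
  rfl

/-- `βη`-equal terms have equal interpretations in every cartesian closed category. -/
theorem BetaEta.tmSem_eq (s : T → C) {Γ : Ctx T} {τ : Ty T} {t t' : Tm Γ τ} (h : BetaEta t t') :
    tmSem s t = tmSem s t' := by
  induction h with
  | refl t => rfl
  | symm _ ih => exact ih.symm
  | trans _ _ ih ih' => exact ih.trans ih'
  | fst_congr _ ih => simp only [tmSem, ih]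
  | snd_congr _ ih => simp only [tmSem, ih]
  | pair_congr _ _ ih ih' => simp only [tmSem, ih, ih']
  | app_congr _ _ ih ih' => simp only [tmSem, ih, ih']
  | lam_congr _ ih => simp only [tmSem, ih]
  | beta_fst a b => exact lift_fst _ _
  | beta_snd a b => exact lift_snd _ _
  | beta_app t a =>
    -- The identity in the second slot of the tuple makes the right side an evaluation of a curried
    -- map.
    rw [tmSem_subst_single, ← Glue.lift_curry_ev, Category.id_comp]
    rfl
  | eta_unit t => exact toUnit_unique _ _
  | eta_pair t => exact (lift_comp_fst_snd _).symm
  | @eta_lam Γ σ τ t =>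
    simp only [tmSem, tmSem_rename, ctxRen_wk, ctxProj]
    exact (Glue.curry_lift_ev (A := tySem s σ) (B := tySem s τ) (tmSem s t)).symm

end Soundness

/-! ### Products and exponentials in the glueing category on elements -/

namespace Glue

variable {K : Type u} [SmallCategory K] {S : Type w} [Category.{v} S]
  [CartesianMonoidalCategory S] {ς : Kᵒᵖ ⥤ S}

/-- Elements of a product over a context are determined by their projections. -/
theorem ctxProd_el_ext {T : Type u} (D : Ty T → Glue ς) {Γ : Ctx T} {c : K}
    {a b : (ctxProd D Γ).P.obj c}
    (h : ∀ (τ : Ty T) (x : Var Γ τ), (ctxProj D x).φ.app c a = (ctxProj D x).φ.app c b) :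
    a = b := by
  induction Γ with
  | nil => rfl
  | ext Γ σ ih => exact Prod.ext (h σ .zero) (ih fun τ x => h τ (.succ x))

variable [MonoidalClosed S]

/-- The closed structure comes from an adjunction built out of hom-set bijections, so its counit is
the inverse transpose of the identity. This and `curry_eq` replace the abstract operations by the
explicit ones. -/
theorem ihom_ev_eq (X Y : Glue ς) : (ihom.ev X).app Y = expEv X Y := by
  change X ◁ 𝟙 (exp X Y) ≫ expEv X Y = expEv X Y
  rw [MonoidalCategory.whiskerLeft_id, Category.id_comp]

theorem curry_eq {Z X Y : Glue ς} (g : X ⊗ Z ⟶ Y) : MonoidalClosed.curry g = expCurry g := by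
  refine ((MonoidalClosed.eq_curry_iff g (expCurry g)).2 ?_).symm
  refine (MonoidalClosed.uncurry_eq (A := X) _).trans ?_
  rw [ihom_ev_eq]
  exact expCurry_ev g

/-- The family of functions underlying an element of an exponential of glued objects. -/
def expApp {X Y : Glue ς} {c : K} (r : ((ihom X).obj Y).P.obj c) (d : K) (ρ : c ⟶ d)
    (a : X.P.obj d) : Y.P.obj d :=
  ExpEl.φ (X := X) (Y := Y) r d ρ a

theorem expApp_curry {Z X Y : Glue ς} (g : X ⊗ Z ⟶ Y) {c : K} (z : Z.P.obj c) {d : K}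
    (ρ : c ⟶ d) (a : X.P.obj d) :
    expApp ((MonoidalClosed.curry g).φ.app c z) d ρ a =
      g.φ.app d (show X.P.obj d × Z.P.obj d from (a, Z.P.map ρ z)) := by
  rw [curry_eq]
  rfl

theorem ev_app (X Y : Glue ς) {c : K} (a : X.P.obj c) (r : ((ihom X).obj Y).P.obj c) :
    ((ihom.ev X).app Y).φ.app c (show X.P.obj c × ((ihom X).obj Y).P.obj c from (a, r)) =
      expApp r c (𝟙 c) a := by
  rw [ihom_ev_eq]
  rfl

theorem expApp_map {X Y : Glue ς} {c d e : K} (ρ : c ⟶ d) (ρ' : d ⟶ e)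
    (r : ((ihom X).obj Y).P.obj c) (a : X.P.obj e) :
    expApp (((ihom X).obj Y).P.map ρ r) e ρ' a = expApp r e (ρ ≫ ρ') a :=
  rfl

/-- Like `expApp_ihom_map`, this rests on writing the map as a transpose, to which `expApp_curry`
applies. The two lemmas compute the two exponential factors of the quote map at function types. -/
theorem expApp_pre {X X' : Glue ς} (g : X' ⟶ X) (Y : Glue ς) {c : K}
    (r : ((ihom X).obj Y).P.obj c) {d : K} (ρ : c ⟶ d) (a : X'.P.obj d) :
    expApp (((MonoidalClosed.pre g).app Y).φ.app c r) d ρ a = expApp r d ρ (g.φ.app d a) := by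
  have h : (MonoidalClosed.pre g).app Y = MonoidalClosed.curry (g ▷ _ ≫ (ihom.ev X).app Y) := by
    rw [MonoidalClosed.eq_curry_iff, MonoidalClosed.uncurry_pre]
  rw [h, expApp_curry]
  refine (ev_app X Y (g.φ.app d a) _).trans ?_
  rw [expApp_map, Category.comp_id]

theorem expApp_ihom_map (X : Glue ς) {Y Y' : Glue ς} (g : Y ⟶ Y') {c : K}
    (r : ((ihom X).obj Y).P.obj c) {d : K} (ρ : c ⟶ d) (a : X.P.obj d) :
    expApp (((ihom X).map g).φ.app c r) d ρ a = g.φ.app d (expApp r d ρ a) := by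
  have h : (ihom X).map g = MonoidalClosed.curry ((ihom.ev X).app Y ≫ g) := by
    rw [MonoidalClosed.eq_curry_iff, MonoidalClosed.uncurry_eq, ihom.ev_naturality]
  rw [h, expApp_curry]
  refine congrArg (g.φ.app d) ?_
  refine (ev_app X Y a _).trans ?_
  rw [expApp_map, Category.comp_id]

end Glue

/-! ### Quote and unquote on elements -/

section Elements

variable {T : Type u} {S : Type w} [Category.{v} S] [CartesianMonoidalCategory S]
  [MonoidalClosed S]

/-- The elements of the presheaf of the interpretation of `τ` in the glueing category. -/
abbrev El (s : T → S) (Γ : Ctx T) (τ : Ty T) : Type (max u v) :=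
  (tySem (glueInterp s) τ).P.obj Γ

/-- The elements of the presheaf of the interpretation of `Γ` in the glueing category. -/
abbrev Env (s : T → S) (Δ Γ : Ctx T) : Type (max u v) :=
  (ctxProd (tySem (glueInterp s)) Γ).P.obj Δ

/-- Unquoting of a neutral term. -/
def reflect (s : T → S) {Γ : Ctx T} {τ : Ty T} (M : Ne Γ τ) : El s Γ τ :=
  (unquote s τ).φ.app Γ ⟨M⟩

/-- Quoting of an element. -/
def reify (s : T → S) {Γ : Ctx T} {τ : Ty T} (a : El s Γ τ) : Nf Γ τ :=
  ((quote s τ).φ.app Γ a).down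

/-- The value of a term at an environment. -/
def eval (s : T → S) {Δ Γ : Ctx T} {τ : Ty T} (t : Tm Γ τ) (γ : Env s Δ Γ) : El s Δ τ :=
  (tmSem (glueInterp s) t).φ.app Δ γ

/-- The value of a variable at an environment. -/
def lookup (s : T → S) {Δ Γ : Ctx T} {τ : Ty T} (x : Var Γ τ) (γ : Env s Δ Γ) : El s Δ τ :=
  (ctxProj (tySem (glueInterp s)) x).φ.app Δ γ

/-- An environment extended by an element for the last variable. -/
def consEnv (s : T → S) {Δ Γ : Ctx T} {σ : Ty T} (a : El s Δ σ) (γ : Env s Δ Γ) :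
    Env s Δ (Γ.ext σ) :=
  show El s Δ σ × Env s Δ Γ from (a, γ)

/-- The action of renamings on elements. -/
def renEl (s : T → S) {Γ Δ : Ctx T} {τ : Ty T} (ρ : Γ ⟶ Δ) (a : El s Γ τ) : El s Δ τ :=
  (tySem (glueInterp s) τ).P.map ρ a

/-- The action of renamings on environments. -/
def renEnv (s : T → S) {Δ Δ' Γ : Ctx T} (ρ : Δ ⟶ Δ') (γ : Env s Δ Γ) : Env s Δ' Γ :=
  (ctxProd (tySem (glueInterp s)) Γ).P.map ρ γ

/-- Application of an element of function type at a later stage. -/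
def appEl (s : T → S) {Γ Δ : Ctx T} {σ τ : Ty T} (r : El s Γ (.arr σ τ)) (ρ : Γ ⟶ Δ)
    (a : El s Δ σ) : El s Δ τ :=
  Glue.expApp r Δ ρ a

variable (s : T → S)

theorem lookup_renEnv {Δ Δ' Γ : Ctx T} {τ : Ty T} (x : Var Γ τ) (ρ : Δ ⟶ Δ') (γ : Env s Δ Γ) :
    lookup s x (renEnv s ρ γ) = renEl s ρ (lookup s x γ) :=
  Glue.φ_map _ ρ γ

theorem renEl_reflect {Γ Δ : Ctx T} {τ : Ty T} (ρ : Γ ⟶ Δ) (M : Ne Γ τ) :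
    renEl s ρ (reflect s M) = reflect s ⟨M.1.rename ρ, M.2.rename ρ⟩ :=
  (Glue.φ_map (unquote s τ) ρ ⟨M⟩).symm

theorem eval_app {Δ Γ : Ctx T} {σ τ : Ty T} (t : Tm Γ (.arr σ τ)) (t' : Tm Γ σ)
    (γ : Env s Δ Γ) :
    eval s (t.app t') γ = appEl s (eval s t γ) (𝟙 Δ) (eval s t' γ) :=
  Glue.ev_app _ _ _ _

theorem appEl_eval_lam {Δ Δ' Γ : Ctx T} {σ τ : Ty T} (t : Tm (Γ.ext σ) τ)
    (γ : Env s Δ Γ) (ρ : Δ ⟶ Δ') (a : El s Δ' σ) :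
    appEl s (eval s t.lam γ) ρ a = eval s t (consEnv s a (renEnv s ρ γ)) :=
  Glue.expApp_curry _ _ _ _

theorem appEl_renEl {Γ Δ Δ' : Ctx T} {σ τ : Ty T} (r : El s Γ (.arr σ τ)) (ρ : Γ ⟶ Δ)
    (ρ' : Δ ⟶ Δ') (a : El s Δ' σ) :
    appEl s (renEl s ρ r) ρ' a = appEl s r (ρ ≫ ρ') a :=
  rfl

/-- Unquoting at a function type is by definition a transpose: it quotes the argument, forms the
neutral application, and unquotes the result. -/
theorem appEl_reflect {Γ Δ : Ctx T} {σ τ : Ty T} (M : Ne Γ (.arr σ τ)) (ρ : Γ ⟶ Δ)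
    (a : El s Δ σ) :
    appEl s (reflect s M) ρ a =
      reflect s ⟨.app (M.1.rename ρ) (reify s a).1, .app (M.2.rename ρ) (reify s a).2⟩ :=
  Glue.expApp_curry _ _ _ _

/-- The last variable of a context as an element of the interpretation of its type. -/
def lastEl (Γ : Ctx T) (σ : Ty T) : El s (Γ.ext σ) σ :=
  reflect s ⟨.var .zero, .var _⟩

/-- Quoting at a function type applies the element, one variable later, to the unquoted fresh
variable, quotes the result and abstracts. -/
theorem reify_arr {Γ : Ctx T} {σ τ : Ty T} (r : El s Γ (.arr σ τ)) :
    (reify s r).1 = .lam (reify s (appEl s r (Ren.wk Γ σ) (lastEl s Γ σ))).1 := by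
  refine congrArg (fun N : ULift.{v} (Nf (Γ.ext σ) τ) => Tm.lam N.down.1) ?_
  refine (Glue.expApp_ihom_map (varObj s σ) (quote s τ) _ (Ren.wk Γ σ) ⟨.zero⟩).trans ?_
  exact congrArg ((quote s τ).φ.app _)
    (Glue.expApp_pre (varMap s σ ≫ unquote s σ) _ r (Ren.wk Γ σ) ⟨.zero⟩)

/-- The environment sending each variable to its unquoting. -/
def idEnv (Γ : Ctx T) : Env s Γ Γ :=
  (varCtx s Γ ≫ unquoteCtx s Γ).φ.app Γ ⟨𝟙 Γ⟩

theorem lookup_idEnv {Γ : Ctx T} {τ : Ty T} (x : Var Γ τ) :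
    lookup s x (idEnv s Γ) = reflect s ⟨.var x, .var x⟩ :=
  congrArg (fun g : yonObj s Γ ⟶ tySem (glueInterp s) τ => g.φ.app Γ ⟨𝟙 Γ⟩)
    (varCtx_unquoteCtx_proj s x)

/-- Unquoting is natural, so the old variables may be unquoted before or after weakening. This lets
the induction on normal terms pass under an abstraction. -/
theorem idEnv_ext (Γ : Ctx T) (σ : Ty T) :
    idEnv s (Γ.ext σ) = consEnv s (lastEl s Γ σ) (renEnv s (Ren.wk Γ σ) (idEnv s Γ)) := by
  apply Glue.ctxProd_el_ext
  intro τ x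
  refine (lookup_idEnv s x).trans ?_
  cases x with
  | zero => rfl
  | succ x =>
    refine Eq.trans ?_ (lookup_renEnv s x (Ren.wk Γ σ) (idEnv s Γ)).symm
    rw [lookup_idEnv]
    exact (renEl_reflect s (Ren.wk Γ σ) ⟨.var x, .var x⟩).symm

theorem normalise_eq {Γ : Ctx T} {τ : Ty T} (t : Tm Γ τ) :
    normalise s t = reify s (eval s t (idEnv s Γ)) :=
  rfl

end Elements

/-! ### Normalisation fixes normal terms -/

section Normal

variable {T : Type u} {S : Type w} [Category.{v} S] [CartesianMonoidalCategory S]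
  [MonoidalClosed S] (s : T → S)

-- These are the two halves of one induction: a neutral application needs its normal argument
-- recovered by quoting, and a normal term of base type is a neutral one.
mutual

theorem IsNeutral.eval_idEnv {Γ : Ctx T} {τ : Ty T} {M : Tm Γ τ} :
    ∀ h : IsNeutral M, eval s M (idEnv s Γ) = reflect s ⟨M, h⟩
  | .var x => lookup_idEnv s x
  | .fst h => congrArg Prod.fst (IsNeutral.eval_idEnv h)
  | .snd h => congrArg Prod.snd (IsNeutral.eval_idEnv h)
  | .app (M := M) (N := N) h h' => by
    rw [eval_app, IsNeutral.eval_idEnv h]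
    refine (appEl_reflect s ⟨M, h⟩ (𝟙 Γ) _).trans (congrArg (reflect s) ?_)
    apply Subtype.ext
    change (M.rename _).app (reify s (eval s N (idEnv s Γ))).1 = M.app N
    rw [M.rename_id, IsNormal.reify_eval_idEnv h']

theorem IsNormal.reify_eval_idEnv {Γ : Ctx T} {τ : Ty T} {N : Tm Γ τ} :
    IsNormal N → (reify s (eval s N (idEnv s Γ))).1 = N
  | .unit => rfl
  | .pair h h' => congrArg₂ Tm.pair (IsNormal.reify_eval_idEnv h) (IsNormal.reify_eval_idEnv h')
  | .lam h => by
    rw [reify_arr, appEl_eval_lam, ← idEnv_ext, IsNormal.reify_eval_idEnv h]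
  | .base h => congrArg (fun M : El s Γ (.base _) => M.down.1) (IsNeutral.eval_idEnv h)

end

theorem normalise_normal {Γ : Ctx T} {τ : Ty T} (N : Nf Γ τ) : normalise s N.1 = N :=
  Subtype.ext (N.2.reify_eval_idEnv s)

/-- Only the middle factor, the interpretation in the glueing category, depends on the term, and it
is invariant by soundness there. -/
theorem BetaEta.normalise_eq {Γ : Ctx T} {τ : Ty T} {t t' : Tm Γ τ} (h : BetaEta t t') :
    normalise s t = normalise s t' := by
  rw [NbE.normalise_eq, NbE.normalise_eq, eval, eval, h.tmSem_eq]

end Normal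

/-! ### The logical relation between terms and elements -/

section LogicalRelation

variable {T : Type u} {S : Type w} [Category.{v} S] [CartesianMonoidalCategory S]
  [MonoidalClosed S] (s : T → S)

/-- The Kripke logical relation between terms and elements of the glued interpretation of types. -/
def Realises : ∀ (τ : Ty T) {Γ : Ctx T}, Tm Γ τ → El s Γ τ → Prop
  | .base _, _, t, M => BetaEta t (ULift.down M).1
  | .unit, _, _, _ => True
  | .prod σ τ, Γ, t, a =>
      Realises σ t.fst (Prod.fst (α := El s Γ σ) (β := El s Γ τ) a) ∧
        Realises τ t.snd (Prod.snd (α := El s Γ σ) (β := El s Γ τ) a)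
  -- Quantifying over all later contexts makes the relation stable under renaming; the instance at
  -- `Ren.wk` is what quoting a function needs.
  | .arr σ τ, Γ, t, r => ∀ (Δ : Ctx T) (ρ : Γ ⟶ Δ) (t' : Tm Δ σ) (a : El s Δ σ),
      Realises σ t' a → Realises τ ((t.rename ρ).app t') (appEl s r ρ a)

variable {s}

theorem Realises.of_betaEta {τ : Ty T} {Γ : Ctx T} {t t' : Tm Γ τ} {a : El s Γ τ}
    (h : BetaEta t t') (ht : Realises s τ t a) : Realises s τ t' a := by
  induction τ generalizing Γ with
  | base b => exact h.symm.trans ht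
  | unit => exact trivial
  | prod σ τ ih ih' => exact ⟨ih h.fst_congr ht.1, ih' h.snd_congr ht.2⟩
  | arr σ τ _ ih' =>
    exact fun Δ ρ u b hu => ih' (.app_congr (h.rename ρ) (.refl u)) (ht Δ ρ u b hu)

theorem Realises.rename {τ : Ty T} {Γ Δ : Ctx T} {t : Tm Γ τ} {a : El s Γ τ}
    (ht : Realises s τ t a) (ρ : Γ ⟶ Δ) : Realises s τ (t.rename ρ) (renEl s ρ a) := by
  induction τ generalizing Γ with
  | base b => exact BetaEta.rename ht ρ
  | unit => exact trivial
  | prod σ τ ih ih' => exact ⟨ih ht.1 ρ, ih' ht.2 ρ⟩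
  | arr σ τ _ _ =>
    intro Θ ρ' u b hu
    rw [appEl_renEl, ← Tm.rename_comp]
    exact ht Θ (ρ ≫ ρ') u b hu

/-- The two claims are proved together because function types are contravariant in their domain:
unquoting a function quotes its arguments, and quoting a function unquotes a fresh variable. -/
theorem realises_reflect_and_reify (τ : Ty T) :
    (∀ {Γ : Ctx T} {t : Tm Γ τ} {M : Ne Γ τ}, BetaEta t M.1 → Realises s τ t (reflect s M)) ∧
      ∀ {Γ : Ctx T} {t : Tm Γ τ} {a : El s Γ τ}, Realises s τ t a → BetaEta t (reify s a).1 := by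
  induction τ with
  | base b => exact ⟨fun h => h, fun h => h⟩
  | unit => exact ⟨fun _ => trivial, fun {Γ t a} _ => .eta_unit t⟩
  | prod σ τ ih ih' =>
    exact ⟨fun {Γ t M} h => ⟨ih.1 (M := ⟨M.1.fst, .fst M.2⟩) h.fst_congr,
        ih'.1 (M := ⟨M.1.snd, .snd M.2⟩) h.snd_congr⟩,
      fun {Γ t a} h => (BetaEta.eta_pair t).trans (.pair_congr (ih.2 h.1) (ih'.2 h.2))⟩
  | arr σ τ ih ih' =>
    refine ⟨fun {Γ t M} h Δ ρ u a hu => ?_, fun {Γ t r} h => ?_⟩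
    · rw [appEl_reflect]
      exact ih'.1 (.app_congr (h.rename ρ) (ih.2 hu))
    · rw [reify_arr]
      -- The `η`-expansion of `t` applies its weakening to the fresh variable, which is related to
      -- its own unquoting.
      exact (BetaEta.eta_lam t).trans
        (.lam_congr (ih'.2 (h _ (Ren.wk Γ σ) _ _ (ih.1 (.refl _)))))

theorem Realises.reflect {τ : Ty T} {Γ : Ctx T} {t : Tm Γ τ} {M : Ne Γ τ} (h : BetaEta t M.1) :
    Realises s τ t (reflect s M) :=
  (realises_reflect_and_reify τ).1 h

theorem Realises.reify {τ : Ty T} {Γ : Ctx T} {t : Tm Γ τ} {a : El s Γ τ}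
    (h : Realises s τ t a) : BetaEta t (reify s a).1 :=
  (realises_reflect_and_reify τ).2 h

/-- The fundamental lemma of the logical relation. -/
theorem realises_subst_eval {Γ : Ctx T} {τ : Ty T} (t : Tm Γ τ) {Δ : Ctx T}
    (θ : ∀ τ : Ty T, Var Γ τ → Tm Δ τ) (γ : Env s Δ Γ)
    (h : ∀ (τ : Ty T) (x : Var Γ τ), Realises s τ (θ τ x) (lookup s x γ)) :
    Realises s τ (t.subst θ) (eval s t γ) := by
  induction t generalizing Δ with
  | var x => exact h _ x
  | unit => exact trivial
  | fst t ih => exact (ih θ γ h).1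
  | snd t ih => exact (ih θ γ h).2
  | pair t t' ih ih' =>
    exact ⟨(ih θ γ h).of_betaEta (BetaEta.beta_fst _ _).symm,
      (ih' θ γ h).of_betaEta (BetaEta.beta_snd _ _).symm⟩
  | app t t' ih ih' =>
    rw [eval_app]
    have := ih θ γ h Δ (𝟙 Δ) _ _ (ih' θ γ h)
    rwa [Tm.rename_id] at this
  | @lam Γ σ τ t ih =>
    intro Δ' ρ u a hu
    rw [appEl_eval_lam]
    -- Closure under `β`-expansion reduces the claim to the body, with `u` and `a` added to the
    -- substitution and the environment.
    refine Realises.of_betaEta (BetaEta.beta_app _ u).symm ?_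
    rw [Tm.subst_liftSub_rename_single]
    refine ih _ _ fun τ x => ?_
    cases x with
    | zero => exact hu
    | succ x =>
      have := (h _ x).rename ρ
      rwa [← lookup_renEnv] at this

variable (s)

/-- The normal form of a term is `βη`-equal to it. -/
theorem betaEta_normalise {Γ : Ctx T} {τ : Ty T} (t : Tm Γ τ) :
    BetaEta (normalise s t).1 t := by
  -- The identity substitution is related to `idEnv` since variables are neutral.
  have h := realises_subst_eval (s := s) t (fun _ x => .var x) (idEnv s Γ) fun τ x => by
    rw [lookup_idEnv]
    exact .reflect (.refl _)
  rw [Tm.subst_var] at h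
  exact h.reify.symm

/-- The normalisation function assigns to a term every normal term `βη`-equal to it. -/
theorem eq_normalise_of_betaEta {Γ : Ctx T} {τ : Ty T} {t : Tm Γ τ} {N : Nf Γ τ}
    (h : BetaEta N.1 t) : N = normalise s t :=
  (normalise_normal s N).symm.trans (h.normalise_eq s)

end LogicalRelation

end NbE

-- Independence of the interpretation, and uniqueness of normal forms.

theorem mainTheorem2 (T : Type u) :
    (∀ (S : Type w) [Category.{v} S] [CartesianMonoidalCategory S] [MonoidalClosed S]
        (s : T → S) (τ : NbE.Ty T),
      NbE.nf s τ = NbE.nf (NbE.FreeCCC.of (T := T)) τ) ∧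
    ∀ (Γ : NbE.Ctx T) (τ : NbE.Ty T) (t : NbE.Tm Γ τ),
      NbE.BetaEta (NbE.normalise NbE.FreeCCC.of t).1 t ∧
        ∀ N : NbE.Nf Γ τ, NbE.BetaEta N.1 t → N = NbE.normalise NbE.FreeCCC.of t := by
  refine ⟨fun S _ _ _ s τ => ?_, fun Γ τ t =>
    ⟨NbE.betaEta_normalise _ t, fun N => NbE.eq_normalise_of_betaEta _⟩⟩
  ext Γ t
  -- The normal form computed with `s` serves as a normal term `βη`-equal to `t`, to which
  -- uniqueness for the universal interpretation applies.
  exact NbE.eq_normalise_of_betaEta NbE.FreeCCC.of (N := NbE.normalise s t)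
    (NbE.betaEta_normalise s t)
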